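/- For integers $n\ge 1$, $p\ge 2$, let $J=(J_{i_1,\dots,i_p})_{1\le i_1,\dots,i_p\le n}$ have i.i.d. standard normal entries, and for $\sigma\in\Sigma_n=\{-1,1\}^n$ let $$H(\sigma)=n^{-\frac{p+1}{2}}\sum_{1\le i_1,\dots,i_p\le n}J_{i_1,\dots,i_p}\,\sigma_{i_1}\cdots\sigma_{i_p},\qquad \mathcal S(\epsilon)=\bigl\{\sigma\in\Sigma_n: H(\sigma)\ge(1-\epsilon)\sqrt{2\ln 2}\bigr\}.$$ Let $d_H$ be the Hamming distance. A set $A\subseteq\Sigma_n$ has the $(\nu_1,\nu_2)$-overlap gap property (OGP) if for all $\sigma,\sigma'\in A$ either $d_H(\sigma,\sigma')\le\nu_1n$ or $d_H(\sigma,\sigma')\ge\nu_2n$. A $(\nu_1,\nu_2)$-clustering of $A$ is a partition of $A$ into non-empty sets (clusters) such that $d_H(\sigma,\sigma')\le\nu_1n$ for $\sigma,\sigma'$ in the same cluster and $d_H(\sigma,\sigma')\ge\nu_2n$ for $\sigma,\sigma'$ in different clusters. **Theorem.** For every $0<\epsilon<1-\frac1{\sqrt2}$ there exist $\hat P\in\mathbb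 N$, $\nu_1,\nu_2$ with $0<\nu_1<\frac12\nu_2<\nu_2<1$, and $c_1>c_2>0$ such that the following holds for every fixed $p\ge\hat P$, both for $A=\mathcal S(\epsilon)$ and, for every $0<\epsilon'<\epsilon$, for $A=\mathcal S(\epsilon)\setminus\mathcal S(\epsilon')$. (a) With probability at least $1-e^{-\Theta(n)}$ as $n\to\infty$, $A$ has the $(\nu_1,\nu_2)$-OGP. (b) With probability at least $1-e^{-\Theta(n)}$ as $n\to\infty$, $|A|\ge 2^{c_1n}$, the set $A$ has a unique $(\nu_1,\nu_2)$-clustering $\mathcal C_1,\dots,\mathcal C_L$, and $\max_{1\le i\le L}|\mathcal C_i|\le 2^{c_2n}$; in particular $L\ge 2^{(c_1-c_2)n}$, so $L=2^{\Omega(n)}$. Here "with probability at least $1-e^{-\Theta(n)}$" means that for some constant $c>0$, which may depend on $p$, $\epsilon$, $\epsilon'$ and the constants above but not on $n$, the probability is at least $1-e^{-cn}$ for all sufficiently large $n$. -/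

import Mathlib

open MeasureTheory ProbabilityTheory Filter

namespace PSpin

/-- The discrete cube `{-1, 1}^n`; the units of `ℤ` are exactly `1` and `-1`. -/
abbrev Config (n : ℕ) : Type := Fin n → ℤˣ

/-- Order-`p` real tensors `(J_{i_1, …, i_p})` with indices in an `n`-element set. -/
abbrev Tensor (n p : ℕ) : Type := (Fin p → Fin n) → ℝ

/-- The law of an order-`p` tensor with i.i.d. standard normal entries. -/
noncomputable def disorder (n p : ℕ) : Measure (Tensor n p) :=
  Measure.pi fun _ => gaussianReal 0 1

/-- The pure `p`-spin Hamiltonian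
`H(σ) = n^{-(p+1)/2} ∑_{i_1, …, i_p} J_{i_1, …, i_p} σ_{i_1} ⋯ σ_{i_p}`. -/
noncomputable def hamiltonian {n p : ℕ} (J : Tensor n p) (σ : Config n) : ℝ :=
  (n : ℝ) ^ (-(((p : ℝ) + 1) / 2)) *
    ∑ i : Fin p → Fin n, J i * ∏ k : Fin p, ((σ (i k) : ℤ) : ℝ)

/-- The super-level set `S(ε) = {σ : H(σ) ≥ (1 - ε) √(2 ln 2)}`. -/
noncomputable def superLevel {n p : ℕ} (J : Tensor n p) (ε : ℝ) : Finset (Config n) :=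
  Finset.univ.filter fun σ => (1 - ε) * Real.sqrt (2 * Real.log 2) ≤ hamiltonian J σ

/-- The `(ν₁, ν₂)`-overlap gap property of a set of configurations. -/
def HasOGP {n : ℕ} (ν₁ ν₂ : ℝ) (A : Finset (Config n)) : Prop :=
  ∀ σ ∈ A, ∀ τ ∈ A,
    (hammingDist σ τ : ℝ) ≤ ν₁ * n ∨ ν₂ * n ≤ (hammingDist σ τ : ℝ)

/-- A partition of `A` into (non-empty) clusters is a `(ν₁, ν₂)`-clustering if each cluster has
diameter at most `ν₁ n` and distinct clusters are at distance at least `ν₂ n`. -/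
def IsClustering {n : ℕ} (ν₁ ν₂ : ℝ) {A : Finset (Config n)} (C : Finpartition A) : Prop :=
  (∀ c ∈ C.parts, ∀ σ ∈ c, ∀ τ ∈ c, (hammingDist σ τ : ℝ) ≤ ν₁ * n) ∧
    ∀ c ∈ C.parts, ∀ d ∈ C.parts, c ≠ d →
      ∀ σ ∈ c, ∀ τ ∈ d, ν₂ * n ≤ (hammingDist σ τ : ℝ)

/-- The events `E n` have probability at least `1 - e^{-Θ(n)}` as `n → ∞`, for fixed `p`. -/
def ExpLikely (p : ℕ) (E : (n : ℕ) → Set (Tensor n p)) : Prop :=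
  ∃ c : ℝ, 0 < c ∧ ∀ᶠ n : ℕ in atTop,
    1 - Real.exp (-c * n) ≤ (disorder n p).real (E n)

/-- The random set `A` breaks into exponentially many well-separated clusters:
with probability `1 - e^{-Θ(n)}` it has the `(ν₁, ν₂)`-overlap gap property; and with probability
`1 - e^{-Θ(n)}` it has at least `2^{c₁ n}` elements, it has exactly one `(ν₁, ν₂)`-clustering,
every cluster in this clustering has at most `2^{c₂ n}` elements, and there are at least
`2^{(c₁ - c₂) n}` clusters. -/
def Shatters (p : ℕ) (ν₁ ν₂ c₁ c₂ : ℝ)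
    (A : (n : ℕ) → Tensor n p → Finset (Config n)) : Prop :=
  ExpLikely p (fun n => {J | HasOGP ν₁ ν₂ (A n J)}) ∧
  ExpLikely p (fun n => {J |
    (2 : ℝ) ^ (c₁ * n) ≤ ((A n J).card : ℝ) ∧
    (∃! C : Finpartition (A n J), IsClustering ν₁ ν₂ C) ∧
    ∀ C : Finpartition (A n J), IsClustering ν₁ ν₂ C →
      (∀ c ∈ C.parts, (c.card : ℝ) ≤ (2 : ℝ) ^ (c₂ * n)) ∧
      (2 : ℝ) ^ ((c₁ - c₂) * n) ≤ (C.parts.card : ℝ)})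

end PSpin

namespace PSpin

/-! For large `p` the covariance `R ^ p / n` of two energies is negligible unless the normalised
overlap `R` is close to `±1`, so the energies behave almost like independent Gaussians of variance
`1 / n`. Write `a` for the threshold `(1 - ε) √(2 log 2)`.

Gap: two configurations both have energy at least `a` with probability at most `exp (-n a² / (1 +
|R| ^ p))`. At intermediate distance `|R|` is bounded away from `1`, so for large `p` this is nearly
`exp (-n a²)`. The condition `ε < 1 - 1/√2` says exactly that `a² > log 2`. If `ν₂` is small there
are only `2 ^ n e ^ (κ n)` pairs closer than `ν₂ n`, and a union bound excludes them
(`expRare_not_hasOGP`).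

Size: the expected number of configurations above `a` is `2 ^ (rate ε * n)` up to subexponential
factors. The second moment exceeds the squared mean by at most a subexponential factor, so
Paley–Zygmund makes the count large only with probability `e ^ (-o(n))`
(`eventually_exp_le_measureReal_le_levelCard`). This is amplified by Gaussian concentration: the
`K`-th largest energy is Lipschitz in the disorder, so it cannot exceed `a + η` with probability `e
^ (-o(n))` and also lie below `a` with probability larger than `e ^ (-Ω(n))`
(`measureReal_le_levelCard_mul_measureReal_levelCard_lt_le`).

Clusters: since `2 ν₁ < ν₂`, the gap makes "at distance at most `ν₁ n`" an equivalence relation on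
the set. Its classes are the only possible clusters, and each lies in a small Hamming ball; dividing
cardinalities gives the number of clusters (`shatters_of_expRare`). -/

/-! ### Concentration of Lipschitz functions of Gaussian vectors. -/

lemma lintegral_exp_mul_gaussianReal (t : ℝ) :
    ∫⁻ x, ENNReal.ofReal (Real.exp (t * x)) ∂(gaussianReal 0 1) =
      ENNReal.ofReal (Real.exp (t ^ 2 / 2)) := by
  rw [← ofReal_integral_eq_lintegral_ofReal (integrable_exp_mul_gaussianReal t)
    (ae_of_all _ fun x => (Real.exp_pos _).le)]
  have h := congrFun (mgf_id_gaussianReal (μ := 0) (v := 1)) t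
  simp only [mgf, id] at h
  rw [h]
  simp

/-- Exponential moments of a Lipschitz function of one standard Gaussian variable. -/
lemma lintegral_exp_mul_lintegral_exp_neg_le_of_lipschitz {L : ℝ} {U : ℝ → ℝ}
    (hU : Measurable U) (hL : ∀ x y, |U x - U y| ≤ L * |x - y|) :
    (∫⁻ x, ENNReal.ofReal (Real.exp (U x)) ∂(gaussianReal 0 1)) *
      (∫⁻ x, ENNReal.ofReal (Real.exp (-U x)) ∂(gaussianReal 0 1)) ≤
      ENNReal.ofReal (Real.exp (L ^ 2)) := by
  set γ := gaussianReal 0 1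
  -- Symmetrisation over two independent copies: only differences of values enter, so the Lipschitz
  -- bound compares `U` with the linear function `L * x`, whose moments are explicit.
  have key : ∀ V : ℝ → ℝ, Measurable V →
      2 * ((∫⁻ x, ENNReal.ofReal (Real.exp (V x)) ∂γ) *
        (∫⁻ x, ENNReal.ofReal (Real.exp (-V x)) ∂γ)) =
      ∫⁻ z, ENNReal.ofReal (2 * Real.cosh (V z.1 - V z.2)) ∂(γ.prod γ) := by
    intro V hV
    have hp : Measurable fun x => ENNReal.ofReal (Real.exp (V x)) := by fun_prop
    have hn : Measurable fun x => ENNReal.ofReal (Real.exp (-V x)) := by fun_prop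
    have h1 := lintegral_prod_mul (μ := γ) (ν := γ) hp.aemeasurable hn.aemeasurable
    have h2 := lintegral_prod_mul (μ := γ) (ν := γ) hn.aemeasurable hp.aemeasurable
    rw [two_mul, ← h1]
    nth_rewrite 2 [h1]
    rw [mul_comm (∫⁻ x, _ ∂γ), ← h2, ← lintegral_add_left (by fun_prop)]
    refine lintegral_congr fun z => ?_
    rw [← ENNReal.ofReal_mul (Real.exp_pos _).le, ← ENNReal.ofReal_mul (Real.exp_pos _).le,
      ← ENNReal.ofReal_add (by positivity) (by positivity), ← Real.exp_add, ← Real.exp_add,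
      Real.cosh_eq]
    congr 1
    rw [show -(V z.1 - V z.2) = -V z.1 + V z.2 by ring, show V z.1 - V z.2 = V z.1 + -V z.2 by ring]
    ring
  have hUL : 2 * ((∫⁻ x, ENNReal.ofReal (Real.exp (U x)) ∂γ) *
      (∫⁻ x, ENNReal.ofReal (Real.exp (-U x)) ∂γ)) ≤
      2 * ENNReal.ofReal (Real.exp (L ^ 2)) := by
    calc _ = ∫⁻ z, ENNReal.ofReal (2 * Real.cosh (U z.1 - U z.2)) ∂(γ.prod γ) := key U hU
      _ ≤ ∫⁻ z, ENNReal.ofReal (2 * Real.cosh (L * z.1 - L * z.2)) ∂(γ.prod γ) := by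
        refine lintegral_mono fun z => ENNReal.ofReal_le_ofReal ?_
        have : Real.cosh (U z.1 - U z.2) ≤ Real.cosh (L * z.1 - L * z.2) := by
          rw [Real.cosh_le_cosh, ← mul_sub, abs_mul]
          exact (hL _ _).trans (mul_le_mul_of_nonneg_right (le_abs_self L) (abs_nonneg _))
        linarith
      _ = _ := by
        rw [← key (fun x => L * x) (by fun_prop)]
        simp only [← neg_mul]
        rw [lintegral_exp_mul_gaussianReal, lintegral_exp_mul_gaussianReal,
          ← ENNReal.ofReal_mul (Real.exp_pos _).le, ← Real.exp_add]
        congr 3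
        ring_nf
  exact (ENNReal.mul_le_mul_iff_right (by simp) (by simp)).1 hUL

/-- Tensorisation. Integrating out all coordinates but the first turns `exp F` into `exp U`, where
`U` is again `L`-Lipschitz. By induction the same integral of `exp (-F)` is at most `C * exp (-U)`,
and the one-variable bound for `U` contributes one more factor `exp (L ^ 2)`. -/
lemma lintegral_exp_mul_lintegral_exp_neg_le_fin (N : ℕ) {L : ℝ} (F : (Fin N → ℝ) → ℝ)
    (hF : Measurable F) (hL : ∀ x y, |F x - F y| ≤ L * ∑ i, |x i - y i|) :
    (∫⁻ x, ENNReal.ofReal (Real.exp (F x)) ∂(Measure.pi fun _ : Fin N => gaussianReal 0 1)) *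
      (∫⁻ x, ENNReal.ofReal (Real.exp (-F x)) ∂(Measure.pi fun _ : Fin N => gaussianReal 0 1)) ≤
      ENNReal.ofReal (Real.exp (N * L ^ 2)) := by
  induction N with
  | zero =>
    have : ∀ x, F x = F 0 := fun x => congrArg F (Subsingleton.elim _ _)
    simp only [this]
    rw [lintegral_const, lintegral_const]
    simp [← ENNReal.ofReal_mul (Real.exp_pos _).le, ← Real.exp_add]
  | succ N ih =>
    set γ := gaussianReal 0 1 with hγ
    set π := Measure.pi fun _ : Fin N => γ with hπ
    have hmp := (measurePreserving_piFinSuccAbove (fun _ : Fin (N + 1) => γ) 0).symm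
    have hcons : ∀ z : ℝ × (Fin N → ℝ),
        (MeasurableEquiv.piFinSuccAbove (fun _ : Fin (N + 1) => ℝ) 0).symm z =
          Fin.cons z.1 z.2 := fun z => Fin.insertNth_zero' (β := ℝ) z.1 z.2
    have hG : Measurable fun z : ℝ × (Fin N → ℝ) => F (Fin.cons z.1 z.2) := by
      simpa only [Function.comp_def, hcons] using hF.comp hmp.measurable
    have split : ∀ f : (Fin (N + 1) → ℝ) → ℝ, Measurable f →
        ∫⁻ x, ENNReal.ofReal (Real.exp (f x)) ∂(Measure.pi fun _ : Fin (N + 1) => γ) =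
          ∫⁻ x, ∫⁻ y, ENNReal.ofReal (Real.exp (f (Fin.cons x y))) ∂π ∂γ := by
      intro f hf
      rw [← hmp.lintegral_comp (by fun_prop), lintegral_prod]
      · simp only [hcons]
        rfl
      · exact (((Real.measurable_exp.comp hf).ennreal_ofReal).comp hmp.measurable).aemeasurable
    have hLx : ∀ x x' y, |F (Fin.cons x y) - F (Fin.cons x' y)| ≤ L * |x - x'| := by
      intro x x' y
      simpa [Fin.sum_univ_succ] using hL (Fin.cons x y) (Fin.cons x' y)
    set u : ℝ → ENNReal := fun x => ∫⁻ y, ENNReal.ofReal (Real.exp (F (Fin.cons x y))) ∂π with hu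
    set v : ℝ → ENNReal := fun x => ∫⁻ y, ENNReal.ofReal (Real.exp (-F (Fin.cons x y))) ∂π with hv
    set C := ENNReal.ofReal (Real.exp (N * L ^ 2)) with hC
    have hum : Measurable u := by
      apply Measurable.lintegral_prod_right'
        (f := fun z : ℝ × (Fin N → ℝ) => ENNReal.ofReal (Real.exp (F (Fin.cons z.1 z.2))))
      fun_prop
    have hFx : ∀ x, Measurable fun y : Fin N → ℝ => F (Fin.cons x y) := fun x =>
      hG.comp (measurable_const.prodMk measurable_id)
    have huv : ∀ x, u x * v x ≤ C := fun x =>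
      ih (fun y => F (Fin.cons x y)) (hFx x) fun y y' => by
        simpa [Fin.sum_univ_succ] using hL (Fin.cons x y) (Fin.cons x y')
    have hpos : ∀ f : (Fin N → ℝ) → ℝ, Measurable f →
        ∫⁻ y, ENNReal.ofReal (Real.exp (f y)) ∂π ≠ 0 := by
      intro f hf h0
      rw [lintegral_eq_zero_iff (by fun_prop)] at h0
      have : ∀ᵐ y ∂π, False := by
        filter_upwards [h0] with y hy
        have : 0 < Real.exp (f y) := Real.exp_pos _
        simp at hy
        linarith
      exact (IsProbabilityMeasure.ne_zero π) (by simpa using this)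
    have hu0 : ∀ x, u x ≠ 0 := fun x => hpos _ (hFx x)
    have hv0 : ∀ x, v x ≠ 0 := fun x => hpos _ (hFx x).neg
    have hut : ∀ x, u x ≠ ⊤ := fun x h => by
      have := huv x
      rw [h, ENNReal.top_mul (hv0 x), top_le_iff] at this
      simp [hC] at this
    have hle : ∀ x x', (u x).toReal ≤ Real.exp (L * |x - x'|) * (u x').toReal := by
      intro x x'
      have : u x ≤ ENNReal.ofReal (Real.exp (L * |x - x'|)) * u x' := by
        rw [hu, ← lintegral_const_mul _ (by have := hFx x'; fun_prop)]
        refine lintegral_mono fun y => ?_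
        rw [← ENNReal.ofReal_mul (Real.exp_pos _).le, ← Real.exp_add]
        apply ENNReal.ofReal_le_ofReal
        apply Real.exp_le_exp.2
        linarith [(abs_le.1 (hLx x x' y)).2]
      have := ENNReal.toReal_mono (ENNReal.mul_ne_top (by simp) (hut x')) this
      rwa [ENNReal.toReal_mul, ENNReal.toReal_ofReal (Real.exp_pos _).le] at this
    have hup : ∀ x, 0 < (u x).toReal := fun x => ENNReal.toReal_pos (hu0 x) (hut x)
    set U : ℝ → ℝ := fun x => Real.log (u x).toReal with hU
    have hUL : ∀ x x', U x - U x' ≤ L * |x - x'| := by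
      intro x x'
      have := Real.log_le_log (hup x) (hle x x')
      rw [Real.log_mul (Real.exp_pos _).ne' (hup x').ne', Real.log_exp] at this
      simp only [hU]
      linarith
    have hUe : ∀ x, ENNReal.ofReal (Real.exp (U x)) = u x := fun x => by
      rw [hU, Real.exp_log (hup x), ENNReal.ofReal_toReal (hut x)]
    have hUv : ∀ x, v x ≤ C * ENNReal.ofReal (Real.exp (-U x)) := fun x => by
      have h1 : ENNReal.ofReal (Real.exp (-U x)) = (u x)⁻¹ := by
        rw [← hUe x, Real.exp_neg, ENNReal.ofReal_inv_of_pos (Real.exp_pos _)]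
      rw [h1, ← div_eq_mul_inv, ENNReal.le_div_iff_mul_le (Or.inl (hu0 x)) (Or.inl (hut x)),
        mul_comm]
      exact huv x
    have hUm : Measurable U := by
      simp only [hU]; fun_prop
    have hone := lintegral_exp_mul_lintegral_exp_neg_le_of_lipschitz hUm (L := L) fun x y =>
      abs_le.2 ⟨by have := hUL y x; rw [abs_sub_comm] at this; linarith, hUL x y⟩
    rw [split F hF, split (fun x => -F x) hF.neg]
    change (∫⁻ x, u x ∂γ) * (∫⁻ x, v x ∂γ) ≤ _
    calc (∫⁻ x, u x ∂γ) * (∫⁻ x, v x ∂γ)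
        ≤ (∫⁻ x, ENNReal.ofReal (Real.exp (U x)) ∂γ) *
          (C * ∫⁻ x, ENNReal.ofReal (Real.exp (-U x)) ∂γ) := by
          rw [← lintegral_const_mul C (by fun_prop)]
          exact mul_le_mul' (lintegral_mono fun x => (hUe x).ge) (lintegral_mono hUv)
      _ = C * ((∫⁻ x, ENNReal.ofReal (Real.exp (U x)) ∂γ) *
          ∫⁻ x, ENNReal.ofReal (Real.exp (-U x)) ∂γ) := by ring
      _ ≤ C * ENNReal.ofReal (Real.exp (L ^ 2)) := by gcongr
      _ = _ := by
        rw [hC, ← ENNReal.ofReal_mul (Real.exp_pos _).le, ← Real.exp_add]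
        congr 2
        push_cast
        ring

/-- Exponential moments of an `ℓ¹`-Lipschitz function of i.i.d. standard Gaussian variables. -/
lemma lintegral_exp_mul_lintegral_exp_neg_le {ι : Type*} [Fintype ι] {L : ℝ} {F : (ι → ℝ) → ℝ}
    (hF : Measurable F) (hL : ∀ x y, |F x - F y| ≤ L * ∑ i, |x i - y i|) :
    (∫⁻ x, ENNReal.ofReal (Real.exp (F x)) ∂(Measure.pi fun _ : ι => gaussianReal 0 1)) *
      (∫⁻ x, ENNReal.ofReal (Real.exp (-F x)) ∂(Measure.pi fun _ : ι => gaussianReal 0 1)) ≤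
      ENNReal.ofReal (Real.exp (Fintype.card ι * L ^ 2)) := by
  let e := (Fintype.equivFin ι).symm
  have hmp := measurePreserving_piCongrLeft (fun _ : ι => gaussianReal 0 1) e
  rw [← hmp.lintegral_comp (by fun_prop), ← hmp.lintegral_comp (by fun_prop)]
  refine lintegral_exp_mul_lintegral_exp_neg_le_fin _ (fun x => F _) (hF.comp hmp.measurable) ?_
  intro x y
  refine (hL _ _).trans_eq ?_
  congr 1
  rw [← e.sum_comp]
  refine Finset.sum_congr rfl fun i _ => ?_
  have h : ∀ x : Fin (Fintype.card ι) → ℝ,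
      MeasurableEquiv.piCongrLeft (fun _ => ℝ) e x (e i) = x i := fun x =>
    MeasurableEquiv.piCongrLeft_apply_apply (β := fun _ => ℝ) e x i
  rw [h, h]

/-- Sets of Gaussian vectors separated by an `ℓ¹`-Lipschitz function. -/
lemma measure_mul_measure_le_of_separated {ι : Type*} [Fintype ι] {L : ℝ} {F : (ι → ℝ) → ℝ}
    (hF : Measurable F) (hL : ∀ x y, |F x - F y| ≤ L * ∑ i, |x i - y i|) {a b : ℝ} :
    (Measure.pi fun _ : ι => gaussianReal 0 1).real {x | b ≤ F x} *
      (Measure.pi fun _ : ι => gaussianReal 0 1).real {x | F x ≤ a} ≤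
      Real.exp (a - b + Fintype.card ι * L ^ 2) := by
  set π := Measure.pi fun _ : ι => gaussianReal 0 1
  have h1 : ENNReal.ofReal (Real.exp b) * π {x | b ≤ F x} ≤
      ∫⁻ x, ENNReal.ofReal (Real.exp (F x)) ∂π := by
    refine le_trans ?_ (mul_meas_ge_le_lintegral (by fun_prop) (ENNReal.ofReal (Real.exp b)))
    gcongr with x
    intro h
    exact ENNReal.ofReal_le_ofReal (Real.exp_le_exp.2 h)
  have h2 : ENNReal.ofReal (Real.exp (-a)) * π {x | F x ≤ a} ≤
      ∫⁻ x, ENNReal.ofReal (Real.exp (-F x)) ∂π := by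
    refine le_trans ?_ (mul_meas_ge_le_lintegral (by fun_prop) (ENNReal.ofReal (Real.exp (-a))))
    gcongr with x
    intro h
    exact ENNReal.ofReal_le_ofReal (Real.exp_le_exp.2 (neg_le_neg h))
  have h3 := (mul_le_mul' h1 h2).trans (lintegral_exp_mul_lintegral_exp_neg_le hF hL)
  have h4 := ENNReal.toReal_mono (by simp) h3
  rw [ENNReal.toReal_mul, ENNReal.toReal_mul, ENNReal.toReal_mul,
    ENNReal.toReal_ofReal (Real.exp_pos _).le, ENNReal.toReal_ofReal (Real.exp_pos _).le,
    ENNReal.toReal_ofReal (Real.exp_pos _).le] at h4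
  have h5 : Real.exp (a - b + Fintype.card ι * L ^ 2) =
      Real.exp a * Real.exp (-b) * Real.exp (Fintype.card ι * L ^ 2) := by
    rw [← Real.exp_add, ← Real.exp_add]; ring_nf
  have ea : Real.exp a * Real.exp (-a) = 1 := by rw [← Real.exp_add]; simp
  have eb : Real.exp b * Real.exp (-b) = 1 := by rw [← Real.exp_add]; simp
  rw [h5]
  calc _ = Real.exp a * Real.exp (-b) *
        (Real.exp b * π.real {x | b ≤ F x} * (Real.exp (-a) * π.real {x | F x ≤ a})) := by
        linear_combination (-(π.real {x | b ≤ F x} * π.real {x | F x ≤ a})) * eb -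
          (π.real {x | b ≤ F x} * π.real {x | F x ≤ a} * (Real.exp b * Real.exp (-b))) * ea
    _ ≤ _ := by
      apply mul_le_mul_of_nonneg_left h4 (by positivity)

/-! ### Upper and lower Gaussian tails of linear forms. -/

section LinearForms

variable {ι : Type*} [Fintype ι]

/-- A linear form in i.i.d. standard Gaussian variables is Gaussian. -/
lemma map_sum_mul_pi_gaussianReal (w : ι → ℝ) (v : NNReal) (hv : ∑ i, w i ^ 2 = v) :
    (Measure.pi fun _ : ι => gaussianReal 0 1).map (fun x => ∑ i, w i * x i) =
      gaussianReal 0 v := by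
  have hm : Measurable fun x : ι → ℝ => ∑ i, w i * x i := by fun_prop
  have : IsProbabilityMeasure
      ((Measure.pi fun _ : ι => gaussianReal 0 1).map (fun x => ∑ i, w i * x i)) :=
    Measure.isProbabilityMeasure_map hm.aemeasurable
  apply Measure.ext_of_charFun
  ext t
  rw [charFun_apply_real, integral_map hm.aemeasurable (by fun_prop), charFun_gaussianReal]
  have h1 : ∀ x : ι → ℝ, Complex.exp (t * ((∑ i, w i * x i : ℝ) : ℂ) * Complex.I) =
      ∏ i, Complex.exp (((t * w i : ℝ) : ℂ) * x i * Complex.I) := by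
    intro x
    rw [← Complex.exp_sum]
    congr 1
    push_cast
    rw [Finset.mul_sum, Finset.sum_mul]
    refine Finset.sum_congr rfl fun i _ => by ring
  simp_rw [h1]
  rw [integral_fintype_prod_eq_prod
    (f := fun (i : ι) (x : ℝ) => Complex.exp (((t * w i : ℝ) : ℂ) * x * Complex.I))]
  simp_rw [← charFun_apply_real, charFun_gaussianReal]
  rw [← Complex.exp_sum]
  congr 1
  have hv' : (v : ℂ) = ∑ i, (w i : ℂ) ^ 2 := by
    have := congrArg (fun r : ℝ => (r : ℂ)) hv
    simpa using this.symm
  rw [hv']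
  push_cast
  rw [Finset.sum_mul, Finset.sum_div, mul_zero, zero_mul, zero_sub, ← Finset.sum_neg_distrib]
  refine Finset.sum_congr rfl fun i _ => ?_
  ring

lemma measureReal_le_sum_mul_le (w : ι → ℝ) {v t : ℝ} (hv : 0 < v) (hw : ∑ i, w i ^ 2 ≤ v)
    (ht : 0 ≤ t) :
    (Measure.pi fun _ : ι => gaussianReal 0 1).real {x | t ≤ ∑ i, w i * x i} ≤
      Real.exp (-(t ^ 2 / (2 * v))) := by
  set s : NNReal := ⟨∑ i, w i ^ 2, Finset.sum_nonneg fun i _ => sq_nonneg _⟩ with hs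
  have hm : Measurable fun x : ι → ℝ => ∑ i, w i * x i := by fun_prop
  have hlaw := map_sum_mul_pi_gaussianReal w s rfl
  have h1 : (Measure.pi fun _ : ι => gaussianReal 0 1).real {x | t ≤ ∑ i, w i * x i} =
      (gaussianReal 0 s).real (Set.Ici t) := by
    conv_rhs => rw [← hlaw, map_measureReal_apply hm measurableSet_Ici]
    rfl
  -- Chernoff with the tilt optimal for the variance bound `v`; the true variance `s` may be
  -- smaller, even zero.
  have h2 := measure_ge_le_exp_mul_mgf (X := id) (μ := gaussianReal 0 s) t (t := t / v)
    (by positivity) (integrable_exp_mul_gaussianReal _)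
  rw [mgf_id_gaussianReal, ← Real.exp_add] at h2
  rw [h1]
  refine le_trans h2 (Real.exp_le_exp.2 ?_)
  have h3 : (s : ℝ) * (t / v) ^ 2 / 2 ≤ v * (t / v) ^ 2 / 2 := by
    gcongr
    exact hw
  have h4 : v * (t / v) ^ 2 / 2 = t ^ 2 / (2 * v) := by field_simp
  have h5 : -(t / v) * t = - (2 * (t ^ 2 / (2 * v))) := by field_simp
  linarith

lemma le_measureReal_le_sum_mul (w : ι → ℝ) {t : ℝ} (hw : ∑ i, w i ^ 2 = 1) (ht : 0 ≤ t) :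
    (Real.sqrt (2 * Real.pi))⁻¹ * Real.exp (-((t + 1) ^ 2 / 2)) ≤
      (Measure.pi fun _ : ι => gaussianReal 0 1).real {x | t ≤ ∑ i, w i * x i} := by
  have hm : Measurable fun x : ι → ℝ => ∑ i, w i * x i := by fun_prop
  have hlaw := map_sum_mul_pi_gaussianReal w 1 (by simpa using hw)
  have h1 : (Measure.pi fun _ : ι => gaussianReal 0 1).real {x | t ≤ ∑ i, w i * x i} =
      (gaussianReal 0 1).real (Set.Ici t) := by
    conv_rhs => rw [← hlaw, map_measureReal_apply hm measurableSet_Ici]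
    rfl
  rw [h1]
  -- On this unit interval the density is at least its value at `t + 1`.
  have h2 : (gaussianReal 0 1).real (Set.Icc t (t + 1)) ≤ (gaussianReal 0 1).real (Set.Ici t) :=
    measureReal_mono Set.Icc_subset_Ici_self
  refine le_trans ?_ h2
  rw [measureReal_def, gaussianReal_apply_eq_integral 0 one_ne_zero, ENNReal.toReal_ofReal
    (integral_nonneg fun x => gaussianPDFReal_nonneg _ _ _)]
  have h3 : ∫ x in Set.Icc t (t + 1), (Real.sqrt (2 * Real.pi))⁻¹ *
      Real.exp (-((t + 1) ^ 2 / 2)) ≤ ∫ x in Set.Icc t (t + 1), gaussianPDFReal 0 1 x := by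
    refine setIntegral_mono_on ?_ (integrable_gaussianPDFReal 0 1).integrableOn
      measurableSet_Icc ?_
    · exact integrableOn_const (by simp)
    · intro x hx
      rw [gaussianPDFReal_def]
      simp only [NNReal.coe_one, mul_one, sub_zero]
      gcongr
      rw [neg_div]
      have : x ^ 2 ≤ (t + 1) ^ 2 := pow_le_pow_left₀ (ht.trans hx.1) hx.2 2
      linarith
  simpa using h3

end LinearForms

/-! ### Overlaps and tails of one or two energies. -/

variable {n p : ℕ}

instance : IsProbabilityMeasure (disorder n p) := by
  unfold disorder
  infer_instance

/-- The (unnormalised) overlap `∑ σ_j τ_j`. -/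
noncomputable def overlap (σ τ : Config n) : ℝ := ∑ j, ((σ j : ℤ) : ℝ) * ((τ j : ℤ) : ℝ)

lemma spin_sq (u : ℤˣ) : ((u : ℤ) : ℝ) * ((u : ℤ) : ℝ) = 1 := by
  rcases Int.units_eq_one_or u with h | h <;> simp [h]

lemma overlap_self (σ : Config n) : overlap σ σ = n := by
  simp [overlap, spin_sq]

lemma overlap_eq_sub_hammingDist (σ τ : Config n) :
    overlap σ τ = n - 2 * (hammingDist σ τ : ℝ) := by
  have h : ∀ j, ((σ j : ℤ) : ℝ) * ((τ j : ℤ) : ℝ) = 1 - 2 * (if σ j ≠ τ j then (1 : ℝ) else 0) := by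
    intro j
    rcases Int.units_eq_one_or (σ j) with h | h <;> rcases Int.units_eq_one_or (τ j) with h' | h' <;>
      simp [h, h'] <;> norm_num
  simp only [overlap, h, Finset.sum_sub_distrib, ← Finset.mul_sum, hammingDist]
  rw [Finset.sum_boole]
  simp

lemma abs_overlap_le (σ τ : Config n) : |overlap σ τ| ≤ n := by
  have h : (hammingDist σ τ : ℝ) ≤ n := by
    have := hammingDist_le_card_fintype (x := σ) (y := τ)
    rw [Fintype.card_fin] at this
    exact_mod_cast this
  have h0 : (0 : ℝ) ≤ hammingDist σ τ := Nat.cast_nonneg _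
  rw [overlap_eq_sub_hammingDist, abs_le]
  constructor <;> linarith

lemma sum_prod_mul_prod (σ τ : Config n) :
    ∑ i : Fin p → Fin n, (∏ k, ((σ (i k) : ℤ) : ℝ)) * (∏ k, ((τ (i k) : ℤ) : ℝ)) =
      overlap σ τ ^ p := by
  rw [overlap, Fintype.sum_pow]
  simp only [Finset.prod_mul_distrib]

lemma hamiltonian_eq_sum (J : Tensor n p) (σ : Config n) :
    hamiltonian J σ = ∑ i : Fin p → Fin n,
      ((n : ℝ) ^ (-(((p : ℝ) + 1) / 2)) * ∏ k : Fin p, ((σ (i k) : ℤ) : ℝ)) * J i := by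
  rw [hamiltonian, Finset.mul_sum]
  exact Finset.sum_congr rfl fun i _ => by ring

lemma measurable_hamiltonian (σ : Config n) : Measurable fun J : Tensor n p => hamiltonian J σ := by
  unfold hamiltonian
  fun_prop

lemma scale_sq_mul_pow (hn : 0 < n) :
    ((n : ℝ) ^ (-(((p : ℝ) + 1) / 2))) ^ 2 * (n : ℝ) ^ p = (n : ℝ)⁻¹ := by
  have hn' : (0 : ℝ) < n := by exact_mod_cast hn
  rw [← Real.rpow_natCast, ← Real.rpow_natCast, ← Real.rpow_mul hn'.le, ← Real.rpow_add hn',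
    ← Real.rpow_neg_one]
  congr 1
  push_cast
  ring

/-- The sum of the two energies is at least `2 * a` and is Gaussian of variance `2 / n * (1 + R ^
p)`. The absolute value keeps the variance bound positive when `R ^ p = -1`. -/
lemma measureReal_le_hamiltonian_pair_le (hn : 0 < n) {a : ℝ} (ha : 0 ≤ a) (σ τ : Config n) :
    (disorder n p).real {J | a ≤ hamiltonian J σ ∧ a ≤ hamiltonian J τ} ≤
      Real.exp (-(n * a ^ 2 / (1 + |overlap σ τ / n| ^ p))) := by
  have hn' : (0 : ℝ) < n := by exact_mod_cast hn
  set c := (n : ℝ) ^ (-(((p : ℝ) + 1) / 2)) with hc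
  set w : (Fin p → Fin n) → ℝ := fun i =>
    c * (∏ k : Fin p, ((σ (i k) : ℤ) : ℝ)) + c * ∏ k : Fin p, ((τ (i k) : ℤ) : ℝ) with hw
  have hsum : ∑ i, w i ^ 2 = 2 / n * (1 + (overlap σ τ / n) ^ p) := by
    have h1 : ∀ i, w i ^ 2 = c ^ 2 * ((∏ k : Fin p, ((σ (i k) : ℤ) : ℝ)) *
        (∏ k : Fin p, ((σ (i k) : ℤ) : ℝ))) + 2 * c ^ 2 * ((∏ k : Fin p, ((σ (i k) : ℤ) : ℝ)) *
        (∏ k : Fin p, ((τ (i k) : ℤ) : ℝ))) + c ^ 2 * ((∏ k : Fin p, ((τ (i k) : ℤ) : ℝ)) *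
        (∏ k : Fin p, ((τ (i k) : ℤ) : ℝ))) := fun i => by simp only [hw]; ring
    simp only [h1, Finset.sum_add_distrib, ← Finset.mul_sum, sum_prod_mul_prod, overlap_self]
    have h2 : overlap σ τ ^ p = (n : ℝ) ^ p * (overlap σ τ / n) ^ p := by
      rw [← mul_pow, mul_div_cancel₀ _ hn'.ne']
    have h3 : c ^ 2 * (n : ℝ) ^ p = (n : ℝ)⁻¹ := scale_sq_mul_pow hn
    rw [h2]
    linear_combination (2 + 2 * (overlap σ τ / n) ^ p) * h3
  have hr : (overlap σ τ / n) ^ p ≤ |overlap σ τ / n| ^ p := by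
    rw [← abs_pow]; exact le_abs_self _
  have hr0 : 0 ≤ |overlap σ τ / n| ^ p := by positivity
  have h := measureReal_le_sum_mul_le w (v := 2 / n * (1 + |overlap σ τ / n| ^ p)) (t := 2 * a)
    (by positivity) (by rw [hsum]; gcongr) (by positivity)
  refine le_trans (measureReal_mono ?_) (h.trans_eq ?_)
  · intro J hJ
    have h1 := hJ.1
    have h2 := hJ.2
    rw [hamiltonian_eq_sum] at h1 h2
    simp only [hw, Set.mem_ofPred_eq, add_mul, Finset.sum_add_distrib]
    linarith
  · congr 1
    field_simp

lemma measureReal_le_hamiltonian_le (hn : 0 < n) {a : ℝ} (ha : 0 ≤ a) (σ : Config n) :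
    (disorder n p).real {J | a ≤ hamiltonian J σ} ≤ Real.exp (-(n * a ^ 2 / 2)) := by
  have hn' : (n : ℝ) ≠ 0 := by exact_mod_cast hn.ne'
  have h := measureReal_le_hamiltonian_pair_le (p := p) hn ha σ σ
  rw [overlap_self, div_self hn'] at h
  norm_num at h
  exact h

lemma le_measureReal_le_hamiltonian (hn : 0 < n) {a : ℝ} (ha : 0 ≤ a) (σ : Config n) :
    (Real.sqrt (2 * Real.pi))⁻¹ * Real.exp (-((Real.sqrt n * a + 1) ^ 2 / 2)) ≤
      (disorder n p).real {J | a ≤ hamiltonian J σ} := by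
  have hn' : (0 : ℝ) < n := by exact_mod_cast hn
  set c := (n : ℝ) ^ (-(((p : ℝ) + 1) / 2)) with hc
  set w : (Fin p → Fin n) → ℝ := fun i =>
    Real.sqrt n * (c * (∏ k : Fin p, ((σ (i k) : ℤ) : ℝ))) with hw
  have hsum : ∑ i, w i ^ 2 = 1 := by
    have h1 : ∀ i, w i ^ 2 = n * c ^ 2 * ((∏ k : Fin p, ((σ (i k) : ℤ) : ℝ)) *
        (∏ k : Fin p, ((σ (i k) : ℤ) : ℝ))) := fun i => by
      simp only [hw, mul_pow, Real.sq_sqrt hn'.le]; ring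
    simp only [h1, ← Finset.mul_sum, sum_prod_mul_prod, overlap_self]
    rw [mul_assoc, scale_sq_mul_pow hn, mul_inv_cancel₀ hn'.ne']
  refine (le_measureReal_le_sum_mul w (t := Real.sqrt n * a) hsum (by positivity)).trans_eq ?_
  have hset : {x : Tensor n p | Real.sqrt n * a ≤ ∑ i, w i * x i} =
      {J | a ≤ hamiltonian J σ} := by
    ext J
    have : ∑ i, w i * J i = Real.sqrt n * hamiltonian J σ := by
      rw [hamiltonian_eq_sum, Finset.mul_sum]
      exact Finset.sum_congr rfl fun i _ => by simp only [hw]; ring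
    simp only [Set.mem_ofPred_eq, this]
    exact mul_le_mul_iff_right₀ (by positivity)
  rw [hset, disorder]

/-! ### Counting configurations by overlap. -/

lemma card_config : (Finset.univ : Finset (Config n)).card = 2 ^ n := by
  simp [Config]

lemma sum_exp_mul_overlap (l : ℝ) (σ : Config n) :
    ∑ τ, Real.exp (l * overlap σ τ) = (2 * Real.cosh l) ^ n := by
  have h : ∀ τ : Config n, Real.exp (l * overlap σ τ) =
      ∏ j, Real.exp (l * (((σ j : ℤ) : ℝ) * ((τ j : ℤ) : ℝ))) := by
    intro τ
    rw [overlap, Finset.mul_sum, Real.exp_sum]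
  simp_rw [h]
  rw [← Fintype.piFinset_univ, ← Finset.prod_univ_sum (fun _ => Finset.univ)
    (fun (j : Fin n) (u : ℤˣ) => Real.exp (l * (((σ j : ℤ) : ℝ) * ((u : ℤ) : ℝ))))]
  rw [Finset.prod_congr rfl (g := fun _ => 2 * Real.cosh l), Finset.prod_const, Finset.card_univ,
    Fintype.card_fin]
  intro j _
  rw [UnitsInt.univ, Finset.sum_pair (by decide), Real.cosh_eq]
  rcases Int.units_eq_one_or (σ j) with h | h <;> simp [h] <;> ring

lemma card_le_abs_overlap_le {l : ℝ} (hl : 0 ≤ l) (s : ℝ) (σ : Config n) :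
    ((Finset.univ.filter fun τ => s ≤ |overlap σ τ|).card : ℝ) ≤
      2 * ((2 * Real.cosh l) ^ n * Real.exp (-(l * s))) := by
  have h1 : ∀ τ : Config n, (if s ≤ |overlap σ τ| then (1 : ℝ) else 0) ≤
      Real.exp (l * overlap σ τ) * Real.exp (-(l * s)) +
        Real.exp (-l * overlap σ τ) * Real.exp (-(l * s)) := by
    intro τ
    split_ifs with h
    · rw [← Real.exp_add, ← Real.exp_add]
      rcases le_abs.1 h with h | h
      · have : 1 ≤ Real.exp (l * overlap σ τ + -(l * s)) :=
          Real.one_le_exp (by nlinarith)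
        linarith [Real.exp_pos (-l * overlap σ τ + -(l * s))]
      · have : 1 ≤ Real.exp (-l * overlap σ τ + -(l * s)) :=
          Real.one_le_exp (by nlinarith)
        linarith [Real.exp_pos (l * overlap σ τ + -(l * s))]
    · positivity
  have h2 := Finset.sum_le_sum fun τ (_ : τ ∈ (Finset.univ : Finset (Config n))) => h1 τ
  rw [Finset.sum_add_distrib, ← Finset.sum_mul, ← Finset.sum_mul, sum_exp_mul_overlap,
    sum_exp_mul_overlap, Real.cosh_neg, Finset.sum_boole] at h2
  linarith

/-- Hoeffding's bound for the overlap with a uniformly random configuration. -/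
lemma card_le_abs_overlap_le_hoeffding (hn : 0 < n) {s : ℝ} (hs : 0 ≤ s) (σ : Config n) :
    ((Finset.univ.filter fun τ => s ≤ |overlap σ τ|).card : ℝ) ≤
      2 * (2 ^ n * Real.exp (-(s ^ 2 / (2 * n)))) := by
  have hn' : (0 : ℝ) < n := by exact_mod_cast hn
  refine (card_le_abs_overlap_le (l := s / n) (by positivity) s σ).trans ?_
  have h1 : Real.cosh (s / n) ^ n ≤ Real.exp (s ^ 2 / (2 * n)) := by
    calc Real.cosh (s / n) ^ n ≤ Real.exp ((s / n) ^ 2 / 2) ^ n :=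
          pow_le_pow_left₀ (Real.cosh_pos _).le (Real.cosh_le_exp_half_sq _) n
      _ = Real.exp (s ^ 2 / (2 * n)) := by
        rw [← Real.exp_nat_mul]
        congr 1
        field_simp
  rw [mul_pow, mul_assoc]
  have h2 : Real.exp (-(s ^ 2 / (2 * n))) =
      Real.exp (s ^ 2 / (2 * n)) * Real.exp (-(s / n * s)) := by
    rw [← Real.exp_add]
    congr 1
    field_simp
    ring
  rw [h2]
  gcongr

/-- Small Hamming balls (and their antipodes) have exponentially small density. -/
lemma exists_card_le_abs_overlap_le {κ : ℝ} (hκ : 0 < κ) :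
    ∃ r : ℝ, 0 < r ∧ r < 1 ∧ ∀ (n : ℕ) (σ : Config n),
      ((Finset.univ.filter fun τ => r * n ≤ |overlap σ τ|).card : ℝ) ≤
        2 * Real.exp (κ * n) := by
  -- The Chernoff factor per site is `(1 + exp (-2l)) * exp (l * (1 - r))`. A large `l` bounds the
  -- first factor by `exp (κ / 2)`, then `r` close to `1` does the same for the second.
  obtain ⟨l, hl1, hl2⟩ : ∃ l : ℝ, 0 < l ∧ Real.exp (-(2 * l)) ≤ κ / 2 := by
    refine ⟨max 1 (-Real.log (κ / 2)), lt_of_lt_of_le one_pos (le_max_left _ _), ?_⟩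
    rw [← Real.le_log_iff_exp_le (by positivity)]
    have := le_max_left 1 (-Real.log (κ / 2))
    have := le_max_right 1 (-Real.log (κ / 2))
    linarith
  set r : ℝ := max (1 / 2) (1 - κ / (2 * l)) with hr
  refine ⟨r, lt_of_lt_of_le (by norm_num) (le_max_left _ _), ?_, ?_⟩
  · have : 0 < κ / (2 * l) := by positivity
    exact max_lt (by norm_num) (by linarith)
  intro n σ
  refine (card_le_abs_overlap_le hl1.le _ σ).trans ?_
  have h1 : l * (1 - r) ≤ κ / 2 := by
    have : 1 - κ / (2 * l) ≤ r := le_max_right _ _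
    calc l * (1 - r) ≤ l * (κ / (2 * l)) := by gcongr; linarith
      _ = κ / 2 := by field_simp
  have h2 : 2 * Real.cosh l * Real.exp (-(l * r)) ≤ Real.exp κ := by
    have e1 : 2 * Real.cosh l * Real.exp (-(l * r)) =
        (1 + Real.exp (-(2 * l))) * Real.exp (l * (1 - r)) := by
      rw [Real.cosh_eq, add_mul, one_mul, ← Real.exp_add,
        show 2 * ((Real.exp l + Real.exp (-l)) / 2) = Real.exp l + Real.exp (-l) by ring,
        add_mul, ← Real.exp_add, ← Real.exp_add]
      ring_nf
    rw [e1]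
    calc _ ≤ Real.exp (κ / 2) * Real.exp (κ / 2) := by
          gcongr
          linarith [Real.add_one_le_exp (κ / 2)]
      _ = Real.exp κ := by rw [← Real.exp_add]; ring_nf
  have h3 : (2 * Real.cosh l) ^ n * Real.exp (-(l * (r * n))) =
      (2 * Real.cosh l * Real.exp (-(l * r))) ^ n := by
    rw [mul_pow _ (Real.exp _), ← Real.exp_nat_mul]
    ring_nf
  rw [h3, mul_comm κ, Real.exp_nat_mul]
  have : 0 ≤ 2 * Real.cosh l * Real.exp (-(l * r)) :=
    mul_nonneg (mul_nonneg zero_le_two (Real.cosh_pos _).le) (Real.exp_pos _).le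
  gcongr

/-- The exponent is exactly critical for Hoeffding's bound: on each Hamming sphere weight and count
cancel to `2 * 2 ^ n`, and there are `n + 1` spheres. -/
lemma sum_exp_overlap_sq_le (hn : 0 < n) (σ : Config n) :
    ∑ τ, Real.exp (overlap σ τ ^ 2 / (2 * n)) ≤ 2 ^ n * (2 * (n + 1)) := by
  have hmaps : ∀ τ ∈ (Finset.univ : Finset (Config n)),
      hammingDist σ τ ∈ Finset.range (n + 1) := by
    intro τ _
    have := hammingDist_le_card_fintype (x := σ) (y := τ)
    rw [Fintype.card_fin] at this
    exact Finset.mem_range.2 (by omega)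
  rw [← Finset.sum_fiberwise_of_maps_to hmaps]
  have h : ∀ d ∈ Finset.range (n + 1),
      ∑ τ with hammingDist σ τ = d, Real.exp (overlap σ τ ^ 2 / (2 * n)) ≤ 2 * 2 ^ n := by
    intro d _
    set s : ℝ := |(n : ℝ) - 2 * d| with hs
    have h1 : ∀ τ ∈ Finset.univ.filter (fun τ : Config n => hammingDist σ τ = d),
        Real.exp (overlap σ τ ^ 2 / (2 * n)) = Real.exp (s ^ 2 / (2 * n)) := by
      intro τ hτ
      rw [overlap_eq_sub_hammingDist, (Finset.mem_filter.1 hτ).2, hs, sq_abs]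
    rw [Finset.sum_congr rfl h1, Finset.sum_const, nsmul_eq_mul]
    have h2 : ((Finset.univ.filter fun τ : Config n => hammingDist σ τ = d).card : ℝ) ≤
        ((Finset.univ.filter fun τ => s ≤ |overlap σ τ|).card : ℝ) := by
      norm_cast
      apply Finset.card_le_card
      intro τ hτ
      rw [Finset.mem_filter] at hτ ⊢
      refine ⟨hτ.1, ?_⟩
      rw [overlap_eq_sub_hammingDist, hτ.2]
    have h3 := card_le_abs_overlap_le_hoeffding hn (abs_nonneg ((n : ℝ) - 2 * d)) σ
    calc _ ≤ 2 * (2 ^ n * Real.exp (-(s ^ 2 / (2 * n)))) * Real.exp (s ^ 2 / (2 * n)) := by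
          gcongr
          exact h2.trans h3
      _ = 2 * 2 ^ n := by
          rw [mul_assoc, mul_assoc, ← Real.exp_add]
          simp
  refine (Finset.sum_le_sum h).trans_eq ?_
  rw [Finset.sum_const, Finset.card_range, nsmul_eq_mul]
  push_cast
  ring

/-- The sum over pairs of configurations that controls the second moment. -/
lemma sum_exp_pow_overlap_le (hn : 0 < n) (hp : 2 ≤ p) {b r κ : ℝ} (hb : 0 ≤ b)
    (hcard : ∀ σ : Config n,
      ((Finset.univ.filter fun τ => r * n ≤ |overlap σ τ|).card : ℝ) ≤ 2 * Real.exp (κ * n))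
    (hbκ : b / 2 + κ ≤ Real.log 2) (hbr : b * r ^ (p - 2) ≤ 1 / 2) (σ : Config n) :
    ∑ τ, Real.exp (n * b * (|overlap σ τ / n| ^ p / (1 + |overlap σ τ / n| ^ p))) ≤
      2 ^ n * (2 * n + 4) := by
  have hn' : (0 : ℝ) < n := by exact_mod_cast hn
  -- Near `±σ` the weight is at most `exp (n * b / 2)` and few `τ` occur. Elsewhere `R ^ p ≤ r ^ (p
  -- - 2) * R ^ 2` reduces the weight to a Gaussian one.
  have hterm : ∀ τ : Config n,
      Real.exp (n * b * (|overlap σ τ / n| ^ p / (1 + |overlap σ τ / n| ^ p))) ≤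
        Real.exp (overlap σ τ ^ 2 / (2 * n)) +
          Real.exp (n * b / 2) * (if r * n ≤ |overlap σ τ| then (1 : ℝ) else 0) := by
    intro τ
    set R := |overlap σ τ / n| with hR
    have hR0 : 0 ≤ R := abs_nonneg _
    have hρ0 : 0 ≤ R ^ p := by positivity
    split_ifs with h
    · have hR1 : R ≤ 1 := by
        rw [hR, abs_div, abs_of_pos hn', div_le_one hn']
        exact abs_overlap_le σ τ
      have hρ1 : R ^ p ≤ 1 := pow_le_one₀ hR0 hR1
      have h1 : R ^ p / (1 + R ^ p) ≤ 1 / 2 := by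
        rw [div_le_iff₀ (by linarith)]
        linarith
      have h2 : Real.exp (n * b * (R ^ p / (1 + R ^ p))) ≤ Real.exp (n * b / 2) := by
        apply Real.exp_le_exp.2
        calc n * b * (R ^ p / (1 + R ^ p)) ≤ n * b * (1 / 2) := by gcongr
          _ = n * b / 2 := by ring
      linarith [Real.exp_pos (overlap σ τ ^ 2 / (2 * n))]
    · rw [mul_zero, add_zero]
      apply Real.exp_le_exp.2
      have hRr : R ≤ r := by
        rw [hR, abs_div, abs_of_pos hn', div_le_iff₀ hn']
        exact (not_le.1 h).le
      have h1 : R ^ p / (1 + R ^ p) ≤ R ^ p := div_le_self hρ0 (by linarith)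
      have h2 : R ^ p = R ^ (p - 2) * R ^ 2 := by rw [← pow_add]; congr 1; omega
      have h3 : R ^ 2 = overlap σ τ ^ 2 / n ^ 2 := by rw [hR, sq_abs, div_pow]
      calc n * b * (R ^ p / (1 + R ^ p)) ≤ n * b * (r ^ (p - 2) * R ^ 2) := by
            gcongr
            rw [h2] at h1 ⊢
            exact h1.trans (by gcongr)
        _ = n * R ^ 2 * (b * r ^ (p - 2)) := by ring
        _ ≤ n * R ^ 2 * (1 / 2) := by gcongr
        _ = overlap σ τ ^ 2 / (2 * n) := by
            rw [h3]
            field_simp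
  refine (Finset.sum_le_sum fun τ _ => hterm τ).trans ?_
  rw [Finset.sum_add_distrib, ← Finset.mul_sum, Finset.sum_boole]
  have h1 := sum_exp_overlap_sq_le hn σ
  have h2 : Real.exp (n * b / 2) *
      ((Finset.univ.filter fun τ => r * n ≤ |overlap σ τ|).card : ℝ) ≤ 2 ^ n * 2 := by
    calc _ ≤ Real.exp (n * b / 2) * (2 * Real.exp (κ * n)) := by gcongr; exact hcard σ
      _ = 2 * Real.exp (n * (b / 2 + κ)) := by
        rw [mul_left_comm, ← Real.exp_add]
        ring_nf
      _ ≤ 2 * Real.exp (n * Real.log 2) := by gcongr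
      _ = 2 ^ n * 2 := by
        rw [Real.exp_nat_mul, Real.exp_log (by norm_num)]
        ring
  linarith

/-! ### From the overlap gap to a unique clustering. -/

section Clustering

variable {ν₁ ν₂ : ℝ} {A : Finset (Config n)}

lemma HasOGP.mono {B : Finset (Config n)} (h : HasOGP ν₁ ν₂ B) (hAB : A ⊆ B) :
    HasOGP ν₁ ν₂ A :=
  fun σ hσ τ hτ => h σ (hAB hσ) τ (hAB hτ)

/-- The right-hand side does not involve `C`, which gives uniqueness. -/
lemma IsClustering.mem_part_iff {C : Finpartition A} (hC : IsClustering ν₁ ν₂ C)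
    (hν : ν₁ * n < ν₂ * n) {σ τ : Config n} (hσ : σ ∈ A) :
    τ ∈ C.part σ ↔ τ ∈ A ∧ (hammingDist σ τ : ℝ) ≤ ν₁ * n := by
  constructor
  · intro h
    exact ⟨C.le (C.part_mem.2 hσ) h, hC.1 _ (C.part_mem.2 hσ) σ (C.mem_part hσ) τ h⟩
  · rintro ⟨hτ, hd⟩
    by_contra h
    have hne : C.part σ ≠ C.part τ := fun he => h (he ▸ C.mem_part hτ)
    have := hC.2 _ (C.part_mem.2 hσ) _ (C.part_mem.2 hτ) hne σ (C.mem_part hσ) τ (C.mem_part hτ)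
    linarith

lemma HasOGP.existsUnique_isClustering (h : HasOGP ν₁ ν₂ A) (hn : 0 < n) (h0 : 0 < ν₁)
    (hν : ν₁ < ν₂ / 2) : ∃! C : Finpartition A, IsClustering ν₁ ν₂ C := by
  classical
  have hn' : (0 : ℝ) < n := by exact_mod_cast hn
  have hlt : ν₁ * n < ν₂ * n := by nlinarith
  -- Equality is included only for reflexivity outside `A`. Transitivity holds because two steps
  -- cover at most `2 * ν₁ * n < ν₂ * n`, so the gap forces the short alternative.
  let S : Setoid (Config n) :=
    { r := fun σ τ => σ = τ ∨ σ ∈ A ∧ τ ∈ A ∧ (hammingDist σ τ : ℝ) ≤ ν₁ * n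
      iseqv :=
        { refl := fun σ => Or.inl rfl
          symm := by
            rintro σ τ (h | ⟨h1, h2, h3⟩)
            · exact Or.inl h.symm
            · exact Or.inr ⟨h2, h1, by rwa [hammingDist_comm]⟩
          trans := by
            rintro σ τ υ (rfl | ⟨h1, h2, h3⟩) h'
            · exact h'
            · rcases h' with rfl | ⟨h4, h5, h6⟩
              · exact Or.inr ⟨h1, h2, h3⟩
              · refine Or.inr ⟨h1, h5, (h σ h1 υ h5).resolve_right fun hge => ?_⟩
                have : (hammingDist σ υ : ℝ) ≤ hammingDist σ τ + hammingDist τ υ := by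
                  exact_mod_cast hammingDist_triangle σ τ υ
                nlinarith } }
  have hrel : ∀ σ ∈ A, ∀ τ ∈ A,
      τ ∈ (Finpartition.ofSetSetoid S A).part σ ↔ (hammingDist σ τ : ℝ) ≤ ν₁ * n := by
    intro σ hσ τ hτ
    rw [Finpartition.mem_part_ofSetSetoid_iff_rel]
    constructor
    · rintro ⟨-, -, rfl | h⟩
      · simp only [hammingDist_self, Nat.cast_zero]; positivity
      · exact h.2.2
    · exact fun h => ⟨hσ, hτ, Or.inr ⟨hσ, hτ, h⟩⟩
  have hS : IsClustering ν₁ ν₂ (Finpartition.ofSetSetoid S A) := by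
    refine ⟨fun c hc σ hσ τ hτ => ?_, fun c hc d hd hcd σ hσ τ hτ => ?_⟩
    · have hcA := (Finpartition.ofSetSetoid S A).le hc
      rw [← hrel σ (hcA hσ) τ (hcA hτ), Finpartition.part_eq_of_mem _ hc hσ]
      exact hτ
    · have hσA := (Finpartition.ofSetSetoid S A).le hc hσ
      have hτA := (Finpartition.ofSetSetoid S A).le hd hτ
      refine (h σ hσA τ hτA).resolve_left fun hle => hcd ?_
      rw [← hrel σ hσA τ hτA, Finpartition.part_eq_of_mem _ hc hσ] at hle
      exact Finpartition.eq_of_mem_parts _ hc hd hle hτ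
  have key : ∀ C C' : Finpartition A, IsClustering ν₁ ν₂ C → IsClustering ν₁ ν₂ C' →
      C.parts ⊆ C'.parts := by
    intro C C' hC hC' c hc
    obtain ⟨σ, hσ⟩ := C.nonempty_of_mem_parts hc
    have hσA := C.le hc hσ
    have : c = C'.part σ := by
      rw [← C.part_eq_of_mem hc hσ]
      ext τ
      rw [hC.mem_part_iff hlt hσA, hC'.mem_part_iff hlt hσA]
    rw [this]
    exact C'.part_mem.2 hσA
  exact ⟨_, hS, fun C hC => Finpartition.ext ((key _ _ hC hS).antisymm (key _ _ hS hC))⟩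

lemma IsClustering.card_le {C : Finpartition A} (hC : IsClustering ν₁ ν₂ C) {M : ℝ}
    (hM : ∀ σ : Config n, ((Finset.univ.filter fun τ =>
      (1 - 2 * ν₁) * n ≤ |overlap σ τ|).card : ℝ) ≤ M) {c : Finset (Config n)}
    (hc : c ∈ C.parts) : (c.card : ℝ) ≤ M := by
  obtain ⟨σ, hσ⟩ := C.nonempty_of_mem_parts hc
  refine le_trans ?_ (hM σ)
  norm_cast
  apply Finset.card_le_card
  intro τ hτ
  refine Finset.mem_filter.2 ⟨Finset.mem_univ _, le_trans ?_ (le_abs_self _)⟩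
  rw [overlap_eq_sub_hammingDist]
  linarith [hC.1 c hc σ hσ τ hτ]

lemma card_le_card_parts_mul (C : Finpartition A) {M : ℝ}
    (hM : ∀ c ∈ C.parts, (c.card : ℝ) ≤ M) : (A.card : ℝ) ≤ C.parts.card * M := by
  rw [← C.sum_card_parts, Nat.cast_sum, ← nsmul_eq_mul]
  exact Finset.sum_le_card_nsmul _ _ _ hM

end Clustering

/-! ### Exponentially rare events. -/

section Asymptotics

/-- Absorbs the losses of the moment method: `exp (A √n)` from the Gaussian lower tail and a linear
factor from the second moment. -/
lemma eventually_mul_exp_sqrt_le (A C : ℝ) {θ : ℝ} (hθ : 0 < θ) :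
    ∀ᶠ n : ℕ in atTop, C * (n + 1) * Real.exp (A * Real.sqrt n) ≤ Real.exp (θ * n) := by
  set B := Real.log (3 * (|C| + 1)) with hB
  have hy : ∀ᶠ n : ℕ in atTop, max 1 ((A + 1 + |B|) / θ) ≤ Real.sqrt n :=
    (Real.tendsto_sqrt_atTop.comp tendsto_natCast_atTop_atTop).eventually_ge_atTop _
  filter_upwards [hy] with n hn
  set y := Real.sqrt n with hy
  have hy1 : 1 ≤ y := (le_max_left _ _).trans hn
  have hy2 : A + 1 + |B| ≤ θ * y := by
    have := (le_max_right _ _).trans hn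
    rwa [div_le_iff₀' hθ] at this
  have hyn : (n : ℝ) = y ^ 2 := (Real.sq_sqrt (Nat.cast_nonneg n)).symm
  have h1 : (n : ℝ) + 1 ≤ 3 * Real.exp y := by
    have := Real.quadratic_le_exp_of_nonneg (x := y) (by linarith)
    nlinarith
  have h2 : 3 * (|C| + 1) = Real.exp B := (Real.exp_log (by positivity)).symm
  calc C * (n + 1) * Real.exp (A * y) ≤ (|C| + 1) * (3 * Real.exp y) * Real.exp (A * y) := by
        gcongr
        linarith [le_abs_self C]
    _ = Real.exp (B + y + A * y) := by
        rw [Real.exp_add, Real.exp_add, ← h2]; ring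
    _ ≤ Real.exp (θ * n) := by
        apply Real.exp_le_exp.2
        rw [hyn]
        have := le_abs_self B
        have := abs_nonneg B
        nlinarith

lemma eventually_le_exp (C : ℝ) {θ : ℝ} (hθ : 0 < θ) :
    ∀ᶠ n : ℕ in atTop, C ≤ Real.exp (θ * n) := by
  filter_upwards [eventually_mul_exp_sqrt_le 0 |C| hθ] with n hn
  refine le_trans ?_ hn
  rw [zero_mul, Real.exp_zero, mul_one]
  have := abs_nonneg C
  have := le_abs_self C
  nlinarith [(Nat.cast_nonneg n : (0 : ℝ) ≤ n)]

/-- The events `E n` have probability at most `e^{-Θ(n)}`. -/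
def ExpRare (p : ℕ) (E : (n : ℕ) → Set (Tensor n p)) : Prop :=
  ∃ c : ℝ, 0 < c ∧ ∀ᶠ n : ℕ in atTop, (disorder n p).real (E n) ≤ Real.exp (-c * n)

variable {E E' : (n : ℕ) → Set (Tensor n p)}

lemma expRare_of_le (C : ℝ) {κ : ℝ} (hκ : 0 < κ)
    (h : ∀ᶠ n : ℕ in atTop, (disorder n p).real (E n) ≤ C * Real.exp (-κ * n)) : ExpRare p E := by
  refine ⟨κ / 2, by positivity, ?_⟩
  filter_upwards [h, eventually_le_exp C (half_pos hκ)] with n h1 h2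
  calc _ ≤ C * Real.exp (-κ * n) := h1
    _ ≤ Real.exp (κ / 2 * n) * Real.exp (-κ * n) := by gcongr
    _ = _ := by rw [← Real.exp_add]; ring_nf

lemma ExpRare.mono (h : ExpRare p E') (hE : ∀ᶠ n : ℕ in atTop, E n ⊆ E' n) : ExpRare p E := by
  obtain ⟨c, hc, h⟩ := h
  refine ⟨c, hc, ?_⟩
  filter_upwards [h, hE] with n h1 h2
  exact (measureReal_mono h2).trans h1

lemma ExpRare.union (h : ExpRare p E) (h' : ExpRare p E') : ExpRare p fun n => E n ∪ E' n := by
  obtain ⟨c, hc, h⟩ := h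
  obtain ⟨c', hc', h'⟩ := h'
  refine expRare_of_le 2 (κ := min c c') (lt_min hc hc') ?_
  filter_upwards [h, h'] with n h1 h2
  refine (measureReal_union_le _ _).trans ?_
  have h3 : Real.exp (-c * n) ≤ Real.exp (-(min c c') * n) := by
    gcongr; exact min_le_left _ _
  have h4 : Real.exp (-c' * n) ≤ Real.exp (-(min c c') * n) := by
    gcongr; exact min_le_right _ _
  linarith

lemma ExpRare.expLikely_compl (h : ExpRare p fun n => (E n)ᶜ) : ExpLikely p E := by
  obtain ⟨c, hc, h⟩ := h
  refine ⟨c, hc, ?_⟩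
  filter_upwards [h] with n hn
  have h1 := measureReal_union_le (μ := disorder n p) (E n) (E n)ᶜ
  rw [Set.union_compl_self, probReal_univ] at h1
  linarith

end Asymptotics

/-! ### Level counts: moments, Paley–Zygmund and concentration. -/

section Level

/-- The number of configurations of energy at least `a`. -/
noncomputable def levelCard (J : Tensor n p) (a : ℝ) : ℕ :=
  (Finset.univ.filter fun σ => a ≤ hamiltonian J σ).card

lemma card_superLevel (J : Tensor n p) (ε : ℝ) :
    (superLevel J ε).card = levelCard J ((1 - ε) * Real.sqrt (2 * Real.log 2)) := rfl

lemma sq_level (ε : ℝ) : ((1 - ε) * Real.sqrt (2 * Real.log 2)) ^ 2 =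
    (1 - ε) ^ 2 * (2 * Real.log 2) := by
  rw [mul_pow, Real.sq_sqrt]
  have := Real.log_pos one_lt_two
  positivity

lemma measurableSet_le_hamiltonian (a : ℝ) (σ : Config n) :
    MeasurableSet {J : Tensor n p | a ≤ hamiltonian J σ} :=
  measurableSet_le measurable_const (measurable_hamiltonian σ)

lemma levelCard_eq_sum (J : Tensor n p) (a : ℝ) :
    (levelCard J a : ℝ) =
      ∑ σ, {J : Tensor n p | a ≤ hamiltonian J σ}.indicator (fun _ => (1 : ℝ)) J := by
  rw [levelCard, Finset.card_filter]
  push_cast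
  simp [Set.indicator_apply]

lemma integrable_indicator_le_hamiltonian (a : ℝ) (σ : Config n) :
    Integrable ({J : Tensor n p | a ≤ hamiltonian J σ}.indicator fun _ => (1 : ℝ))
      (disorder n p) :=
  (integrable_const 1).indicator (measurableSet_le_hamiltonian a σ)

lemma integrable_levelCard (a : ℝ) :
    Integrable (fun J : Tensor n p => (levelCard J a : ℝ)) (disorder n p) := by
  simp_rw [levelCard_eq_sum]
  exact integrable_finsetSum _ fun σ _ => integrable_indicator_le_hamiltonian a σ

lemma integral_levelCard (a : ℝ) :
    ∫ J : Tensor n p, (levelCard J a : ℝ) ∂(disorder n p) =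
      ∑ σ : Config n, (disorder n p).real {J | a ≤ hamiltonian J σ} := by
  simp_rw [levelCard_eq_sum]
  rw [integral_finsetSum _ fun σ _ => integrable_indicator_le_hamiltonian a σ]
  refine Finset.sum_congr rfl fun σ _ => ?_
  rw [integral_indicator_const _ (measurableSet_le_hamiltonian a σ)]
  simp

lemma levelCard_sq_eq_sum (J : Tensor n p) (a : ℝ) :
    (levelCard J a : ℝ) ^ 2 = ∑ σ, ∑ τ,
      {J : Tensor n p | a ≤ hamiltonian J σ ∧ a ≤ hamiltonian J τ}.indicator
        (fun _ => (1 : ℝ)) J := by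
  rw [levelCard_eq_sum, sq, Finset.sum_mul_sum]
  refine Finset.sum_congr rfl fun σ _ => Finset.sum_congr rfl fun τ _ => ?_
  simp only [Set.indicator_apply, Set.mem_ofPred_eq]
  by_cases h1 : a ≤ hamiltonian J σ <;> by_cases h2 : a ≤ hamiltonian J τ <;> simp [h1, h2]

lemma measurableSet_le_hamiltonian_pair (a : ℝ) (σ τ : Config n) :
    MeasurableSet {J : Tensor n p | a ≤ hamiltonian J σ ∧ a ≤ hamiltonian J τ} :=
  (measurableSet_le_hamiltonian a σ).inter (measurableSet_le_hamiltonian a τ)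

lemma integrable_levelCard_sq (a : ℝ) :
    Integrable (fun J : Tensor n p => (levelCard J a : ℝ) ^ 2) (disorder n p) := by
  simp_rw [levelCard_sq_eq_sum]
  exact integrable_finsetSum _ fun σ _ => integrable_finsetSum _ fun τ _ =>
    (integrable_const 1).indicator (measurableSet_le_hamiltonian_pair a σ τ)

lemma integral_levelCard_sq (a : ℝ) :
    ∫ J : Tensor n p, (levelCard J a : ℝ) ^ 2 ∂(disorder n p) =
      ∑ σ : Config n, ∑ τ : Config n,
        (disorder n p).real {J | a ≤ hamiltonian J σ ∧ a ≤ hamiltonian J τ} := by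
  simp_rw [levelCard_sq_eq_sum]
  rw [integral_finsetSum _ fun σ _ => integrable_finsetSum _ fun τ _ =>
    (integrable_const 1).indicator (measurableSet_le_hamiltonian_pair a σ τ)]
  refine Finset.sum_congr rfl fun σ _ => ?_
  rw [integral_finsetSum _ fun τ _ =>
    (integrable_const 1).indicator (measurableSet_le_hamiltonian_pair a σ τ)]
  refine Finset.sum_congr rfl fun τ _ => ?_
  rw [integral_indicator_const _ (measurableSet_le_hamiltonian_pair a σ τ)]
  simp

/-- The Paley–Zygmund inequality. -/
lemma sq_div_four_le_mul_measureReal {Ω : Type*} [MeasurableSpace Ω] {μ : Measure Ω}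
    [IsProbabilityMeasure μ] {N : Ω → ℝ} (hN : Integrable N μ)
    (hN2 : Integrable (fun x => N x ^ 2) μ) {Q : ℝ} (hQ : 0 < Q) (hm : 0 < ∫ x, N x ∂μ)
    (hNQ : ∫ x, N x ^ 2 ∂μ ≤ Q) :
    (∫ x, N x ∂μ) ^ 2 / 4 ≤ Q * μ.real {x | (∫ x, N x ∂μ) / 2 ≤ N x} := by
  set m := ∫ x, N x ∂μ with hm'
  -- `N` is only assumed integrable, so the event is replaced by a measurable hull of equal measure.
  set B := toMeasurable μ {x | m / 2 ≤ N x} with hB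
  have hBm : MeasurableSet B := measurableSet_toMeasurable _ _
  have hBr : μ.real B = μ.real {x | m / 2 ≤ N x} := by
    rw [measureReal_def, hB, measure_toMeasurable, measureReal_def]
  have hi : Integrable (B.indicator fun _ => (1 : ℝ)) μ := (integrable_const 1).indicator hBm
  -- On `B` this is AM–GM, with weights that make the quadratic term integrate to at most `m / 4`.
  have hpt : ∀ x, N x ≤ m / 2 + Q / m * B.indicator (fun _ => (1 : ℝ)) x +
      m / (4 * Q) * N x ^ 2 := by
    intro x
    have h2 : 0 ≤ m / (4 * Q) * N x ^ 2 := by positivity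
    by_cases hx : m / 2 ≤ N x
    · have hxB : x ∈ B := subset_toMeasurable _ _ hx
      rw [Set.indicator_of_mem hxB, mul_one]
      have : 0 ≤ m / (4 * Q) * (N x - 2 * Q / m) ^ 2 := by positivity
      have e : m / (4 * Q) * (N x - 2 * Q / m) ^ 2 =
          m / (4 * Q) * N x ^ 2 - N x + Q / m := by
        field_simp
        ring
      linarith
    · have h1 : 0 ≤ B.indicator (fun _ => (1 : ℝ)) x :=
        Set.indicator_nonneg (fun _ _ => zero_le_one) x
      have h3 : 0 ≤ Q / m * B.indicator (fun _ => (1 : ℝ)) x := by positivity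
      linarith [not_le.1 hx]
  have hi' : Integrable (fun x => m / 2 + Q / m * B.indicator (fun _ => (1 : ℝ)) x) μ :=
    (integrable_const (m / 2)).add (hi.const_mul (Q / m))
  have h := integral_mono hN (hi'.add (hN2.const_mul (m / (4 * Q)))) hpt
  simp only [Pi.add_apply] at h
  rw [integral_add hi' (hN2.const_mul (m / (4 * Q))), integral_add (integrable_const (m / 2)) (hi.const_mul (Q / m)),
    integral_const_mul, integral_const_mul, integral_indicator_const _ hBm, integral_const,
    probReal_univ, hBr, ← hm'] at h
  simp only [smul_eq_mul, one_mul, mul_one] at h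
  have h4 : m / (4 * Q) * ∫ x, N x ^ 2 ∂μ ≤ m / 4 := by
    calc _ ≤ m / (4 * Q) * Q := by gcongr
      _ = m / 4 := by field_simp
  have h5 : m / 4 ≤ Q / m * μ.real {x | m / 2 ≤ N x} := by linarith
  have h6 : Q / m * μ.real {x | m / 2 ≤ N x} * m = Q * μ.real {x | m / 2 ≤ N x} := by field_simp
  nlinarith

lemma hamiltonian_le_add (J J' : Tensor n p) (σ : Config n) :
    hamiltonian J σ ≤ hamiltonian J' σ +
      (n : ℝ) ^ (-(((p : ℝ) + 1) / 2)) * ∑ i, |J i - J' i| := by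
  have h : ∀ i : Fin p → Fin n, J i * ∏ k : Fin p, ((σ (i k) : ℤ) : ℝ) ≤
      J' i * ∏ k : Fin p, ((σ (i k) : ℤ) : ℝ) + |J i - J' i| := by
    intro i
    have h1 : |∏ k : Fin p, ((σ (i k) : ℤ) : ℝ)| = 1 := by
      rw [Finset.abs_prod]
      refine Finset.prod_eq_one fun k _ => ?_
      rcases Int.units_eq_one_or (σ (i k)) with h | h <;> simp [h]
    have h2 : (J i - J' i) * ∏ k : Fin p, ((σ (i k) : ℤ) : ℝ) ≤ |J i - J' i| := by
      refine (le_abs_self _).trans ?_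
      rw [abs_mul, h1, mul_one]
    linarith
  rw [hamiltonian, hamiltonian, ← mul_add, ← Finset.sum_add_distrib]
  gcongr with i
  exact h i

/-- The `K`-th largest energy. -/
noncomputable def orderStat {K : ℕ} (hK : 0 < K) [Nonempty {T : Finset (Config n) // T.card = K}]
    (J : Tensor n p) : ℝ :=
  Finset.univ.sup' Finset.univ_nonempty fun T : {T : Finset (Config n) // T.card = K} =>
    T.1.inf' (Finset.card_pos.1 (hK.trans_eq T.2.symm)) (hamiltonian J)

section OrderStat

variable {K : ℕ} (hK : 0 < K) [Nonempty {T : Finset (Config n) // T.card = K}]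

/-- Trades the level count, which jumps as `J` varies, for a Lipschitz function of `J`. -/
lemma le_orderStat_iff (J : Tensor n p) (a : ℝ) : a ≤ orderStat hK J ↔ K ≤ levelCard J a := by
  rw [orderStat, Finset.le_sup'_iff]
  simp only [Finset.le_inf'_iff, Finset.mem_univ, true_and]
  constructor
  · rintro ⟨T, hT⟩
    rw [← T.2]
    exact Finset.card_le_card fun σ hσ => Finset.mem_filter.2 ⟨Finset.mem_univ _, hT σ hσ⟩
  · intro h
    obtain ⟨T, hT, hTK⟩ := Finset.exists_subset_card_eq h
    exact ⟨⟨T, hTK⟩, fun σ hσ => (Finset.mem_filter.1 (hT hσ)).2⟩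

lemma measurable_orderStat : Measurable (orderStat hK : Tensor n p → ℝ) := by
  refine measurable_of_Ici fun a => ?_
  have : (orderStat hK : Tensor n p → ℝ) ⁻¹' Set.Ici a =
      ⋃ T : {T : Finset (Config n) // T.card = K}, ⋂ σ ∈ T.1, {J | a ≤ hamiltonian J σ} := by
    ext J
    simp [orderStat, Finset.le_sup'_iff, Finset.le_inf'_iff]
  rw [this]
  exact MeasurableSet.iUnion fun T => Finset.measurableSet_biInter _ fun σ _ =>
    measurableSet_le_hamiltonian a σ

lemma orderStat_le_add (J J' : Tensor n p) :
    orderStat hK J ≤ orderStat hK J' +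
      (n : ℝ) ^ (-(((p : ℝ) + 1) / 2)) * ∑ i, |J i - J' i| := by
  refine Finset.sup'_le _ _ fun T _ => ?_
  rw [← sub_le_iff_le_add]
  refine le_trans ?_ (Finset.le_sup' (fun T : {T : Finset (Config n) // T.card = K} =>
    T.1.inf' (Finset.card_pos.1 (hK.trans_eq T.2.symm)) (hamiltonian J')) (Finset.mem_univ T))
  refine Finset.le_inf' _ _ fun σ hσ => ?_
  have h1 := Finset.inf'_le (hamiltonian J) hσ
  have h2 := hamiltonian_le_add J J' σ
  linarith

end OrderStat

/-- Concentration of the level counts around their typical exponential order. -/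
lemma measureReal_le_levelCard_mul_measureReal_levelCard_lt_le (hn : 0 < n) {K : ℕ} (hK : 0 < K)
    (hK' : K ≤ 2 ^ n) {η : ℝ} (hη : 0 < η) (a : ℝ) :
    (disorder n p).real {J | K ≤ levelCard J (a + η)} *
      (disorder n p).real {J | levelCard J a < K} ≤ Real.exp (-(η ^ 2 / 4) * n) := by
  have hn' : (0 : ℝ) < n := by exact_mod_cast hn
  have hne : Nonempty {T : Finset (Config n) // T.card = K} := by
    rw [← card_config] at hK'
    obtain ⟨T, -, hT⟩ := Finset.exists_subset_card_eq hK'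
    exact ⟨⟨T, hT⟩⟩
  set c := (n : ℝ) ^ (-(((p : ℝ) + 1) / 2)) with hc
  -- Minimises the resulting exponent `-l * η + l ^ 2 / n`; the second term is the `n ^ p`
  -- coordinates times `(l * c) ^ 2`.
  set l : ℝ := η * n / 2 with hl
  have hl0 : 0 < l := by positivity
  have h := measure_mul_measure_le_of_separated (L := l * c)
    (F := fun J : Tensor n p => l * orderStat hK J) ((measurable_orderStat hK).const_mul l)
    (fun J J' => by
      rw [← mul_sub, abs_mul, abs_of_pos hl0, mul_assoc]
      gcongr
      have h1 := orderStat_le_add hK J J'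
      have h2 := orderStat_le_add hK J' J
      simp only [abs_sub_comm (J' _)] at h2
      rw [abs_le]
      constructor <;> linarith) (a := l * a) (b := l * (a + η))
  refine le_trans (mul_le_mul (measureReal_mono ?_) (measureReal_mono ?_) measureReal_nonneg
    measureReal_nonneg) (h.trans_eq ?_)
  · intro J hJ
    exact mul_le_mul_of_nonneg_left ((le_orderStat_iff hK J _).2 hJ) hl0.le
  · intro J hJ
    have : orderStat hK J < a := by
      rw [← not_le, le_orderStat_iff]
      exact not_le.2 hJ
    exact mul_le_mul_of_nonneg_left this.le hl0.le
  · congr 1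
    have h1 : (Fintype.card (Fin p → Fin n) : ℝ) * (l * c) ^ 2 = l ^ 2 * (n : ℝ)⁻¹ := by
      rw [← scale_sq_mul_pow (p := p) hn]
      simp
      ring
    rw [h1, hl]
    field_simp
    ring

end Level

/-! ### Overlap gap and size of the super-level sets. -/

/-- The exponential growth rate, in base `2`, of `S(ε)`. -/
def rate (ε : ℝ) : ℝ := 1 - (1 - ε) ^ 2

lemma rate_lt_rate {δ ε : ℝ} (h : δ < ε) (hε : ε < 1) : rate δ < rate ε := by
  unfold rate
  nlinarith

lemma rate_pos {ε : ℝ} (h : 0 < ε) (hε : ε < 1) : 0 < rate ε := by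
  unfold rate
  nlinarith

lemma two_rpow_eq_exp (x : ℝ) : (2 : ℝ) ^ x = Real.exp (Real.log 2 * x) :=
  Real.rpow_def_of_pos two_pos x

lemma two_pow_eq_exp (n : ℕ) : (2 : ℝ) ^ n = Real.exp (Real.log 2 * n) := by
  rw [mul_comm, Real.exp_nat_mul, Real.exp_log two_pos]

/-- Pairs of near-optimal configurations at intermediate distance do not occur. -/
lemma expRare_not_hasOGP {ε κ r ν₁ ν₂ : ℝ} (hε : ε < 1) (hκ : 0 < κ) (hr : 0 < r)
    (hlevel : Real.log 2 + 4 * κ ≤ ((1 - ε) * Real.sqrt (2 * Real.log 2)) ^ 2)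
    (hcard : ∀ (n : ℕ) (σ : Config n),
      ((Finset.univ.filter fun τ => r * n ≤ |overlap σ τ|).card : ℝ) ≤ 2 * Real.exp (κ * n))
    (hν₂ : r ≤ 1 - 2 * ν₂)
    (hq : ((1 - ε) * Real.sqrt (2 * Real.log 2)) ^ 2 * (1 - 2 * ν₁) ^ p ≤ κ) :
    ExpRare p fun n => {J : Tensor n p | ¬HasOGP ν₁ ν₂ (superLevel J ε)} := by
  set a := (1 - ε) * Real.sqrt (2 * Real.log 2) with ha
  have ha0 : 0 ≤ a := mul_nonneg (by linarith) (Real.sqrt_nonneg _)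
  refine expRare_of_le 2 (κ := 2 * κ) (by positivity) ?_
  filter_upwards [eventually_gt_atTop 0] with n hn
  have hn' : (0 : ℝ) < n := by exact_mod_cast hn
  set T : Config n → Finset (Config n) := fun σ => Finset.univ.filter fun τ =>
    ν₁ * n < (hammingDist σ τ : ℝ) ∧ (hammingDist σ τ : ℝ) < ν₂ * n with hT
  have hsub : {J : Tensor n p | ¬HasOGP ν₁ ν₂ (superLevel J ε)} ⊆
      ⋃ σ ∈ (Finset.univ : Finset (Config n)), ⋃ τ ∈ T σ,
        {J | a ≤ hamiltonian J σ ∧ a ≤ hamiltonian J τ} := by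
    intro J hJ
    simp only [HasOGP, Set.mem_ofPred_eq] at hJ
    push Not at hJ
    obtain ⟨σ, hσ, τ, hτ, h1, h2⟩ := hJ
    simp only [Set.mem_iUnion]
    exact ⟨σ, Finset.mem_univ _, τ, Finset.mem_filter.2 ⟨Finset.mem_univ _, h1, h2⟩,
      (Finset.mem_filter.1 hσ).2, (Finset.mem_filter.1 hτ).2⟩
  have hover : ∀ σ, ∀ τ ∈ T σ, r * n ≤ overlap σ τ ∧ overlap σ τ ≤ (1 - 2 * ν₁) * n := by
    intro σ τ hτ
    obtain ⟨-, h1, h2⟩ := Finset.mem_filter.1 hτ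
    rw [overlap_eq_sub_hammingDist]
    constructor <;> nlinarith
  have hTcard : ∀ σ, ((T σ).card : ℝ) ≤ 2 * Real.exp (κ * n) := by
    intro σ
    refine le_trans ?_ (hcard n σ)
    norm_cast
    refine Finset.card_le_card fun τ hτ => Finset.mem_filter.2 ⟨Finset.mem_univ _, ?_⟩
    exact (hover σ τ hτ).1.trans (le_abs_self _)
  have hpair : ∀ σ, ∀ τ ∈ T σ,
      (disorder n p).real {J | a ≤ hamiltonian J σ ∧ a ≤ hamiltonian J τ} ≤
        Real.exp (-((Real.log 2 + 3 * κ) * n)) := by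
    intro σ τ hτ
    refine (measureReal_le_hamiltonian_pair_le hn ha0 σ τ).trans (Real.exp_le_exp.2 ?_)
    obtain ⟨h1, h2⟩ := hover σ τ hτ
    have h0 : 0 ≤ overlap σ τ := le_trans (by positivity) h1
    set ρ := |overlap σ τ / n| ^ p with hρ
    have hρ0 : 0 ≤ ρ := by positivity
    have hρ1 : ρ ≤ (1 - 2 * ν₁) ^ p := by
      rw [hρ, abs_of_nonneg (by positivity)]
      gcongr
      rwa [div_le_iff₀ hn']
    have h3 : a ^ 2 * ρ ≤ κ := le_trans (by gcongr) hq
    have h4 : n * (a ^ 2 * (1 - ρ)) ≤ n * a ^ 2 / (1 + ρ) := by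
      rw [le_div_iff₀ (by positivity)]
      have : 0 ≤ n * a ^ 2 * ρ ^ 2 := by positivity
      nlinarith
    have h5 : (Real.log 2 + 3 * κ) * n ≤ n * (a ^ 2 * (1 - ρ)) := by
      rw [mul_comm]
      gcongr
      linarith
    linarith
  -- Exponent budget: `log 2` for `σ`, `κ` for `τ`, minus `log 2 + 3κ` for the pair, leaving `-2κ`.
  calc _ ≤ ∑ σ : Config n, ∑ τ ∈ T σ,
        (disorder n p).real {J | a ≤ hamiltonian J σ ∧ a ≤ hamiltonian J τ} := by
        refine (measureReal_mono hsub (measure_ne_top _ _)).trans ((measureReal_biUnion_finset_le _ _).trans ?_)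
        exact Finset.sum_le_sum fun σ _ => measureReal_biUnion_finset_le _ _
    _ ≤ ∑ σ : Config n, 2 * Real.exp (κ * n) * Real.exp (-((Real.log 2 + 3 * κ) * n)) := by
        refine Finset.sum_le_sum fun σ _ => (Finset.sum_le_card_nsmul _ _ _ (hpair σ)).trans ?_
        rw [nsmul_eq_mul]
        gcongr
        exact hTcard σ
    _ = 2 * Real.exp (-(2 * κ) * n) := by
        rw [Finset.sum_const, card_config, nsmul_eq_mul]
        rw [Nat.cast_pow, Nat.cast_ofNat, two_pow_eq_exp, mul_left_comm, mul_assoc,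
          ← Real.exp_add, ← Real.exp_add]
        ring_nf

lemma sum_measureReal_le (hn : 0 < n) {δ : ℝ} (hδ : δ < 1) :
    ∑ σ : Config n, (disorder n p).real
      {J | (1 - δ) * Real.sqrt (2 * Real.log 2) ≤ hamiltonian J σ} ≤ (2 : ℝ) ^ (rate δ * n) := by
  refine (Finset.sum_le_card_nsmul _ _ _ fun σ _ => measureReal_le_hamiltonian_le hn
    (mul_nonneg (by linarith) (Real.sqrt_nonneg _)) σ).trans_eq ?_
  rw [card_config, nsmul_eq_mul, sq_level, two_rpow_eq_exp, rate]
  rw [Nat.cast_pow, Nat.cast_ofNat, two_pow_eq_exp, ← Real.exp_add]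
  ring_nf

/-- First moment upper bound on the size of `S(δ)`. -/
lemma expRare_two_rpow_le_card {δ c : ℝ} (hδ : δ < 1) (hc : rate δ < c) :
    ExpRare p fun n => {J : Tensor n p | (2 : ℝ) ^ (c * n) ≤ ((superLevel J δ).card : ℝ)} := by
  have hlog := Real.log_pos one_lt_two
  refine expRare_of_le 1 (κ := Real.log 2 * (c - rate δ)) (by nlinarith) ?_
  filter_upwards [eventually_gt_atTop 0] with n hn
  have h1 := mul_meas_ge_le_integral_of_nonneg (μ := disorder n p)
    (f := fun J => (levelCard J ((1 - δ) * Real.sqrt (2 * Real.log 2)) : ℝ))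
    (ae_of_all _ fun J => Nat.cast_nonneg _) (integrable_levelCard _) ((2 : ℝ) ^ (c * n))
  rw [integral_levelCard] at h1
  have h2 := h1.trans (sum_measureReal_le hn hδ)
  simp only [card_superLevel]
  rw [← le_div_iff₀' (by positivity)] at h2
  refine le_trans h2 (le_of_eq ?_)
  rw [two_rpow_eq_exp, two_rpow_eq_exp, ← Real.exp_sub, one_mul]
  ring_nf

/-- The event that `S(ε)` is large has probability at least `e^{-o(n)}`. -/
lemma eventually_exp_le_measureReal_le_levelCard {a r κ c θ : ℝ} (hp : 2 ≤ p) (ha : 0 ≤ a)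
    (hcard : ∀ (n : ℕ) (σ : Config n),
      ((Finset.univ.filter fun τ => r * n ≤ |overlap σ τ|).card : ℝ) ≤ 2 * Real.exp (κ * n))
    (haκ : a ^ 2 / 2 + κ ≤ Real.log 2) (har : a ^ 2 * r ^ (p - 2) ≤ 1 / 2) (hc0 : 0 ≤ c)
    (hc : Real.log 2 * c < Real.log 2 - a ^ 2 / 2) (hθ : 0 < θ) :
    ∀ᶠ n : ℕ in atTop, ⌈(2 : ℝ) ^ (c * n)⌉₊ ≤ 2 ^ n ∧
      Real.exp (-θ * n) ≤ (disorder n p).real {J | ⌈(2 : ℝ) ^ (c * n)⌉₊ ≤ levelCard J a} := by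
  have hlog := Real.log_pos one_lt_two
  set s := Real.sqrt (2 * Real.pi) with hs
  have hs0 : 0 < s := by positivity
  filter_upwards [eventually_gt_atTop 0,
    eventually_mul_exp_sqrt_le a (4 * s * Real.exp (1 / 2)) (sub_pos.2 hc),
    eventually_mul_exp_sqrt_le (2 * a) (s ^ 2 * 16 * Real.exp 1) hθ] with n hn h1 h2
  have hn' : (0 : ℝ) < n := by exact_mod_cast hn
  set y := Real.sqrt n with hy
  have hyn : y ^ 2 = n := Real.sq_sqrt hn'.le
  set N : Tensor n p → ℝ := fun J => (levelCard J a : ℝ) with hN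
  set m := ∫ J, N J ∂(disorder n p) with hm
  -- Explicit lower bound for the mean; the cross term `a * y` of the square is the `exp (a √n)`
  -- loss.
  set m₀ := 2 ^ n * (s⁻¹ * Real.exp (-((y * a + 1) ^ 2 / 2))) with hm₀
  have hm₀pos : 0 < m₀ := by positivity
  have hmm : m₀ ≤ m := by
    rw [hm, hN, integral_levelCard]
    have := Finset.card_nsmul_le_sum (Finset.univ : Finset (Config n)) _ _
      fun σ _ => le_measureReal_le_hamiltonian (p := p) hn ha σ
    rw [card_config, nsmul_eq_mul] at this
    push_cast at this
    exact this
  have hK : (⌈(2 : ℝ) ^ (c * n)⌉₊ : ℝ) ≤ m₀ / 2 := by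
    have hone : 1 ≤ (2 : ℝ) ^ (c * n) := Real.one_le_rpow one_le_two (by positivity)
    have e2 : (⌈(2 : ℝ) ^ (c * n)⌉₊ : ℝ) ≤ 2 * (2 : ℝ) ^ (c * n) := by
      have := Nat.ceil_lt_add_one (a := (2 : ℝ) ^ (c * n)) (by positivity)
      linarith
    refine e2.trans ?_
    rw [two_rpow_eq_exp, hm₀, two_pow_eq_exp]
    have e3 : 4 * s * Real.exp (1 / 2) * Real.exp (a * y) ≤
        Real.exp ((Real.log 2 - a ^ 2 / 2 - Real.log 2 * c) * n) := by
      refine le_trans ?_ h1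
      refine mul_le_mul_of_nonneg_right ?_ (Real.exp_pos _).le
      exact le_mul_of_one_le_right (by positivity) (by linarith)
    have e4 : Real.exp (Real.log 2 * n) * (s⁻¹ * Real.exp (-((y * a + 1) ^ 2 / 2))) / 2 =
        Real.exp ((Real.log 2 - a ^ 2 / 2 - Real.log 2 * c) * n) *
          (Real.exp (-(1 / 2)) * Real.exp (-(a * y)) * Real.exp (Real.log 2 * (c * n))) *
            (s⁻¹ / 2) := by
      rw [← Real.exp_add, ← Real.exp_add, ← Real.exp_add, mul_left_comm, ← Real.exp_add]
      rw [mul_comm s⁻¹, mul_div_assoc]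
      congr 2
      rw [← hyn]
      ring
    rw [e4]
    calc _ = 4 * s * Real.exp (1 / 2) * Real.exp (a * y) *
          (Real.exp (-(1 / 2)) * Real.exp (-(a * y)) * Real.exp (Real.log 2 * (c * n))) *
            (s⁻¹ / 2) := by
          rw [Real.exp_neg, Real.exp_neg]
          field_simp
          norm_num
      _ ≤ _ := by gcongr
  have hNle : m ≤ 2 ^ n := by
    have h : ∀ J, N J ≤ 2 ^ n := fun J => by
      have := Finset.card_le_univ (Finset.univ.filter fun σ => a ≤ hamiltonian J σ)
      rw [← Finset.card_univ, card_config] at this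
      simp only [hN, levelCard]
      exact_mod_cast this
    have := integral_mono (μ := disorder n p) (integrable_levelCard a)
      (integrable_const ((2 : ℝ) ^ n)) h
    simpa using this
  refine ⟨?_, ?_⟩
  · have : (⌈(2 : ℝ) ^ (c * n)⌉₊ : ℝ) ≤ 2 ^ n := by linarith
    exact_mod_cast this
  set Q : ℝ := 2 ^ n * (Real.exp (-(n * a ^ 2)) * (2 ^ n * (2 * n + 4))) with hQ
  have hQpos : 0 < Q := by positivity
  have hQle : ∫ J, N J ^ 2 ∂(disorder n p) ≤ Q := by
    rw [hN, integral_levelCard_sq]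
    refine (Finset.sum_le_card_nsmul _ _ (Real.exp (-(n * a ^ 2)) * (2 ^ n * (2 * n + 4)))
      fun σ _ => ?_).trans_eq ?_
    · calc _ ≤ ∑ τ, Real.exp (-(n * a ^ 2)) * Real.exp (n * a ^ 2 *
            (|overlap σ τ / n| ^ p / (1 + |overlap σ τ / n| ^ p))) := by
            refine Finset.sum_le_sum fun τ _ => ?_
            refine (measureReal_le_hamiltonian_pair_le hn ha σ τ).trans_eq ?_
            rw [← Real.exp_add]
            congr 1
            have : 0 < 1 + |overlap σ τ / n| ^ p := by positivity
            field_simp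
            ring
        _ ≤ _ := by
            rw [← Finset.mul_sum]
            gcongr
            exact sum_exp_pow_overlap_le hn hp (sq_nonneg a) (hcard n) haκ har σ
    · rw [card_config, nsmul_eq_mul]
      push_cast
      rfl
  have hPZ := sq_div_four_le_mul_measureReal (integrable_levelCard a) (integrable_levelCard_sq a)
    hQpos (hm₀pos.trans_le hmm) hQle
  have hsub : (disorder n p).real {J | m / 2 ≤ N J} ≤
      (disorder n p).real {J | ⌈(2 : ℝ) ^ (c * n)⌉₊ ≤ levelCard J a} := by
    refine measureReal_mono fun J hJ => ?_
    have h : m / 2 ≤ (levelCard J a : ℝ) := hJ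
    have : (⌈(2 : ℝ) ^ (c * n)⌉₊ : ℝ) ≤ levelCard J a := by linarith
    exact_mod_cast this
  refine le_trans ?_ hsub
  -- The exponential orders of `Q` and `m₀ ^ 2` agree; their ratio is a linear factor times `exp (2
  -- a √n)`.
  have hfin : Q * Real.exp (-θ * n) ≤ m₀ ^ 2 / 4 := by
    have e1 : m₀ ^ 2 / 4 = 2 ^ n * 2 ^ n * (s ^ 2)⁻¹ / 4 * (Real.exp (-(n * a ^ 2)) *
        (Real.exp (2 * a * y) * Real.exp 1)⁻¹) := by
      rw [hm₀, ← Real.exp_add, ← Real.exp_neg, ← Real.exp_add, mul_pow, mul_pow,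
        ← Real.exp_nat_mul, inv_pow]
      have : ((2 : ℕ) : ℝ) * -((y * a + 1) ^ 2 / 2) = -(n * a ^ 2) + -(2 * a * y + 1) := by
        rw [← hyn]; push_cast; ring
      rw [this]
      ring
    have e2 : Real.exp (-θ * n) * (s ^ 2 * 16 * Real.exp 1 * (n + 1) * Real.exp (2 * a * y)) ≤
        1 := by
      calc _ ≤ Real.exp (-θ * n) * Real.exp (θ * n) := by gcongr
        _ = 1 := by rw [← Real.exp_add]; simp
    rw [e1, hQ]
    calc _ = 2 ^ n * 2 ^ n * Real.exp (-(n * a ^ 2)) * ((2 * n + 4) * Real.exp (-θ * n)) := by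
          ring
      _ ≤ 2 ^ n * 2 ^ n * Real.exp (-(n * a ^ 2)) *
          ((s ^ 2)⁻¹ / 4 * (Real.exp (2 * a * y) * Real.exp 1)⁻¹) := by
          refine mul_le_mul_of_nonneg_left ?_ (by positivity)
          have e3 : (s ^ 2)⁻¹ / 4 * (Real.exp (2 * a * y) * Real.exp 1)⁻¹ =
              1 / (4 * s ^ 2 * (Real.exp (2 * a * y) * Real.exp 1)) := by
            field_simp
          rw [e3, le_div_iff₀ (by positivity)]
          refine le_trans ?_ e2
          have : (2 * n + 4 : ℝ) ≤ 4 * (n + 1) := by linarith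
          calc _ ≤ 4 * (n + 1) * Real.exp (-θ * n) *
                (4 * s ^ 2 * (Real.exp (2 * a * y) * Real.exp 1)) := by gcongr
            _ = _ := by ring
      _ = _ := by ring
  have hmsq : m₀ ^ 2 / 4 ≤ m ^ 2 / 4 := by gcongr
  exact le_of_mul_le_mul_left ((hfin.trans hmsq).trans hPZ) hQpos

lemma exists_forall_mul_pow_le (C : ℝ) {r θ : ℝ} (hr0 : 0 ≤ r) (hr : r < 1) (hθ : 0 < θ) :
    ∃ P : ℕ, ∀ p, P ≤ p → C * r ^ p ≤ θ := by
  have h : Tendsto (fun p : ℕ => C * r ^ p) atTop (nhds (C * 0)) :=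
    (tendsto_pow_atTop_nhds_zero_of_lt_one hr0 hr).const_mul C
  rw [mul_zero] at h
  exact eventually_atTop.1 (h.eventually_le_const hθ)

/-- Second moment lower bound on the size of `S(ε)`, amplified by concentration. -/
lemma exists_expRare_card_lt {ε : ℝ} (hε : 0 < ε) (hε' : ε < 1) :
    ∃ P : ℕ, ∀ p, P ≤ p → ∀ c, c < rate ε →
      ExpRare p fun n => {J : Tensor n p | ((superLevel J ε).card : ℝ) < (2 : ℝ) ^ (c * n)} := by
  have hlog := Real.log_pos one_lt_two
  have hs0 : 0 < Real.sqrt (2 * Real.log 2) := by positivity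
  -- `P` must be fixed before `c`. Every auxiliary level `ε₁` used below exceeds `ε / 2`, so this
  -- `κ` serves all of them.
  set κ := rate (ε / 2) * Real.log 2 with hκ
  have hκ0 : 0 < κ := mul_pos (rate_pos (by linarith) (by linarith)) hlog
  obtain ⟨r, hr0, hr1, hcard⟩ := exists_card_le_abs_overlap_le hκ0
  obtain ⟨P, hP⟩ := exists_forall_mul_pow_le (2 * Real.log 2) hr0.le hr1 one_half_pos
  refine ⟨P + 2, fun p hp c hc => ?_⟩
  set d := max c 0 with hd
  have hd0 : 0 ≤ d := le_max_right _ _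
  have hdε : d < rate ε := max_lt hc (rate_pos hε hε')
  -- A slightly higher energy level that still has growth rate above `d`; the margin `η` pays for
  -- the concentration step.
  obtain ⟨ε₁, h1, h2, h3⟩ : ∃ ε₁, d < rate ε₁ ∧ ε / 2 < ε₁ ∧ ε₁ < ε := by
    have hcont : Continuous rate := by unfold rate; fun_prop
    have e1 : ∀ᶠ y in nhdsWithin ε (Set.Iio ε), d < rate y :=
      (hcont.continuousAt.eventually_const_lt hdε).filter_mono nhdsWithin_le_nhds
    have e2 : ∀ᶠ y in nhdsWithin ε (Set.Iio ε), ε / 2 < y :=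
      (eventually_gt_nhds (by linarith)).filter_mono nhdsWithin_le_nhds
    exact (e1.and (e2.and self_mem_nhdsWithin)).exists
  set a := (1 - ε) * Real.sqrt (2 * Real.log 2) with ha
  set η := (ε - ε₁) * Real.sqrt (2 * Real.log 2) with hη
  have hη0 : 0 < η := mul_pos (by linarith) hs0
  have haη : a + η = (1 - ε₁) * Real.sqrt (2 * Real.log 2) := by rw [ha, hη]; ring
  have hsq : (a + η) ^ 2 = (1 - rate ε₁) * (2 * Real.log 2) := by
    rw [haη, sq_level, rate]; ring
  have hrate : rate (ε / 2) < rate ε₁ := rate_lt_rate h2 (by linarith)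
  have hrate0 : 0 < rate ε₁ := rate_pos (by linarith) (by linarith)
  have hmain := eventually_exp_le_measureReal_le_levelCard (p := p) (a := a + η) (r := r) (κ := κ)
    (c := d) (θ := η ^ 2 / 8) (by omega)
    (by rw [haη]; exact mul_nonneg (by linarith) hs0.le) hcard
    (by rw [hsq, hκ]; nlinarith)
    (by
      refine le_trans ?_ (hP (p - 2) (by omega))
      rw [hsq]
      refine mul_le_mul_of_nonneg_right ?_ (by positivity)
      nlinarith)
    hd0 (by rw [hsq]; nlinarith) (by positivity)
  refine expRare_of_le 1 (κ := η ^ 2 / 8) (by positivity) ?_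
  filter_upwards [hmain, eventually_gt_atTop 0] with n hn hn0
  obtain ⟨hK, hB⟩ := hn
  set K := ⌈(2 : ℝ) ^ (d * n)⌉₊ with hKdef
  have hK0 : 0 < K := Nat.ceil_pos.2 (by positivity)
  have hconc := measureReal_le_levelCard_mul_measureReal_levelCard_lt_le (p := p) hn0 hK0 hK hη0 a
  have hsub : (disorder n p).real {J | ((superLevel J ε).card : ℝ) < (2 : ℝ) ^ (c * n)} ≤
      (disorder n p).real {J | levelCard J a < K} := by
    refine measureReal_mono fun J hJ => ?_
    have e1 : ((superLevel J ε).card : ℝ) < (2 : ℝ) ^ (c * n) := hJ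
    have e2 : (2 : ℝ) ^ (c * n) ≤ (2 : ℝ) ^ (d * n) := by
      gcongr
      · exact one_le_two
      · exact le_max_left _ _
    exact Nat.lt_ceil.2 (e1.trans_le e2)
  refine hsub.trans ?_
  have e1 : Real.exp (-(η ^ 2 / 8) * n) * (disorder n p).real {J | levelCard J a < K} ≤
      Real.exp (-(η ^ 2 / 4) * n) :=
    (mul_le_mul_of_nonneg_right hB measureReal_nonneg).trans hconc
  have e2 : Real.exp (-(η ^ 2 / 4) * n) =
      Real.exp (-(η ^ 2 / 8) * n) * (1 * Real.exp (-(η ^ 2 / 8) * n)) := by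
    rw [one_mul, ← Real.exp_add]; ring_nf
  rw [e2] at e1
  exact le_of_mul_le_mul_left e1 (Real.exp_pos _)

/-- The set `S(ε) \ S(δ)` is exponentially large. -/
lemma expRare_card_sdiff_lt {ε δ c : ℝ} (hε' : ε < 1) (hδ : δ < ε) (hc : c < rate ε)
    (h : ∀ c, c < rate ε →
      ExpRare p fun n => {J : Tensor n p | ((superLevel J ε).card : ℝ) < (2 : ℝ) ^ (c * n)}) :
    ExpRare p fun n => {J : Tensor n p |
      ((superLevel J ε \ superLevel J δ).card : ℝ) < (2 : ℝ) ^ (c * n)} := by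
  set g := max c (rate δ) with hg
  have hgε : g < rate ε := max_lt hc (rate_lt_rate hδ hε')
  -- Since `rate δ < c'' < c' < rate ε`, removing fewer than `2 ^ (c'' n)` points from at least `2 ^
  -- (c' n)` leaves at least `2 ^ (c'' n)` for large `n`.
  set c' := (g + 2 * rate ε) / 3 with hc'
  set c'' := (2 * g + rate ε) / 3 with hc''
  have hgc : c ≤ g := le_max_left _ _
  have hgδ : rate δ ≤ g := le_max_right _ _
  refine ((h c' (by linarith)).union
    (expRare_two_rpow_le_card (p := p) (δ := δ) (c := c'') (by linarith) (by linarith))).mono ?_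
  have hev : ∀ᶠ n : ℕ in atTop, 1 / (c' - c'') ≤ (n : ℝ) :=
    tendsto_natCast_atTop_atTop.eventually_ge_atTop _
  filter_upwards [hev] with n hn J hJ
  have hJ' : ((superLevel J ε \ superLevel J δ).card : ℝ) < (2 : ℝ) ^ (c * n) := hJ
  by_contra hcon
  simp only [Set.mem_union, Set.mem_ofPred_eq, not_or, not_lt, not_le] at hcon
  obtain ⟨h1, h2⟩ := hcon
  have h3 : ((superLevel J ε).card : ℝ) ≤
      (superLevel J ε \ superLevel J δ).card + (superLevel J δ).card := by
    have := Finset.le_card_sdiff (superLevel J δ) (superLevel J ε)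
    norm_cast
    omega
  have h4 : (2 : ℝ) ^ (c * n) ≤ (2 : ℝ) ^ (c'' * n) := by
    gcongr
    · exact one_le_two
    · linarith
  have h5 : 2 * (2 : ℝ) ^ (c'' * n) ≤ (2 : ℝ) ^ (c' * n) := by
    have hpos : 0 < c' - c'' := by linarith
    rw [div_le_iff₀' hpos] at hn
    calc 2 * (2 : ℝ) ^ (c'' * n) = (2 : ℝ) ^ (1 + c'' * n) := by
          rw [Real.rpow_add two_pos, Real.rpow_one]
      _ ≤ (2 : ℝ) ^ (c' * n) := by
          gcongr
          · exact one_le_two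
          · linarith
  linarith

/-- Apart from the two rare events everything is deterministic. Half of the exponent `c₂` bounds the
ball around a cluster member; the other half absorbs the factor `2`. -/
lemma shatters_of_expRare {ν₁ ν₂ c₁ c₂ r : ℝ} (h0 : 0 < ν₁) (hν : ν₁ < ν₂ / 2) (hc₂ : 0 < c₂)
    (hr : r ≤ 1 - 2 * ν₁)
    (hcard : ∀ (n : ℕ) (σ : Config n), ((Finset.univ.filter fun τ =>
      r * n ≤ |overlap σ τ|).card : ℝ) ≤ 2 * Real.exp (Real.log 2 * c₂ / 2 * n))
    {A : (n : ℕ) → Tensor n p → Finset (Config n)}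
    (hOGP : ExpRare p fun n => {J | ¬HasOGP ν₁ ν₂ (A n J)})
    (hA : ExpRare p fun n => {J | ((A n J).card : ℝ) < (2 : ℝ) ^ (c₁ * n)}) :
    Shatters p ν₁ ν₂ c₁ c₂ A := by
  have hlog := Real.log_pos one_lt_two
  refine ⟨ExpRare.expLikely_compl hOGP, ExpRare.expLikely_compl ((hOGP.union hA).mono ?_)⟩
  filter_upwards [eventually_gt_atTop 0,
    eventually_le_exp 2 (θ := Real.log 2 * c₂ / 2) (by positivity)] with n hn hn2
  have hball : ∀ σ : Config n, ((Finset.univ.filter fun τ =>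
      (1 - 2 * ν₁) * n ≤ |overlap σ τ|).card : ℝ) ≤ (2 : ℝ) ^ (c₂ * n) := by
    intro σ
    calc _ ≤ ((Finset.univ.filter fun τ => r * n ≤ |overlap σ τ|).card : ℝ) := by
          norm_cast
          refine Finset.card_le_card (Finset.monotone_filter_right _ fun τ _ h => ?_)
          exact le_trans (by gcongr) h
      _ ≤ 2 * Real.exp (Real.log 2 * c₂ / 2 * n) := hcard n σ
      _ ≤ Real.exp (Real.log 2 * c₂ / 2 * n) * Real.exp (Real.log 2 * c₂ / 2 * n) := by gcongr
      _ = (2 : ℝ) ^ (c₂ * n) := by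
          rw [two_rpow_eq_exp, ← Real.exp_add]
          ring_nf
  rw [Set.compl_subset_comm]
  intro J hJ
  simp only [Set.mem_compl_iff, Set.mem_union, Set.mem_ofPred_eq, not_or, not_not, not_lt] at hJ
  obtain ⟨hJ1, hJ2⟩ := hJ
  refine ⟨hJ2, hJ1.existsUnique_isClustering hn h0 hν, fun C hC => ?_⟩
  have hsize : ∀ c ∈ C.parts, (c.card : ℝ) ≤ (2 : ℝ) ^ (c₂ * n) := fun c hc =>
    hC.card_le hball hc
  refine ⟨hsize, ?_⟩
  have h1 := hJ2.trans (card_le_card_parts_mul C hsize)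
  rw [sub_mul, Real.rpow_sub two_pos, div_le_iff₀ (by positivity)]
  exact h1

end PSpin

/-! ### Choice of constants. -/

theorem mainTheorem2 (ε : ℝ) (hε : 0 < ε) (hε' : ε < 1 - 1 / Real.sqrt 2) :
    ∃ (P : ℕ) (ν₁ ν₂ c₁ c₂ : ℝ),
      0 < ν₁ ∧ ν₁ < ν₂ / 2 ∧ ν₂ / 2 < ν₂ ∧ ν₂ < 1 ∧ 0 < c₂ ∧ c₂ < c₁ ∧
      ∀ p : ℕ, P ≤ p →
        PSpin.Shatters p ν₁ ν₂ c₁ c₂ (fun _ J => PSpin.superLevel J ε) ∧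
        ∀ δ : ℝ, 0 < δ → δ < ε →
          PSpin.Shatters p ν₁ ν₂ c₁ c₂
            (fun _ J => PSpin.superLevel J ε \ PSpin.superLevel J δ) := by
  have hlog := Real.log_pos one_lt_two
  have hsqrt : 0 < 1 / Real.sqrt 2 := by positivity
  have hε1 : ε < 1 := by linarith
  have hhalf : 1 / 2 < (1 - ε) ^ 2 := by
    have h1 : (1 / Real.sqrt 2) ^ 2 = 1 / 2 := by
      rw [div_pow, Real.sq_sqrt zero_le_two, one_pow]
    rw [← h1]
    exact pow_lt_pow_left₀ (by linarith) hsqrt.le two_ne_zero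
  -- A quarter of the excess of the squared threshold over `log 2`.
  set κ := Real.log 2 * (2 * (1 - ε) ^ 2 - 1) / 4 with hκ
  have hκ0 : 0 < κ := by
    have : 0 < Real.log 2 * (2 * (1 - ε) ^ 2 - 1) := mul_pos hlog (by linarith)
    positivity
  set c₁ := PSpin.rate ε / 2 with hc₁
  have hrate := PSpin.rate_pos hε hε1
  set c₂ := c₁ / 2 with hc₂
  have hc₂0 : 0 < c₂ := by positivity
  obtain ⟨r, hr0, hr1, hcard⟩ := PSpin.exists_card_le_abs_overlap_le hκ0
  obtain ⟨r', hr'0, hr'1, hcard'⟩ :=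
    PSpin.exists_card_le_abs_overlap_le (κ := Real.log 2 * c₂ / 2) (by positivity)
  -- Distance below `ν₂ * n` then means overlap above `r * n`. In `ν₁`, the first bound gives `ν₁ <
  -- ν₂ / 2` and the second keeps clusters small; `P'` depends on `ν₁` and so comes last.
  set ν₂ := (1 - r) / 2 with hν₂
  set ν₁ := min (ν₂ / 4) ((1 - r') / 2) with hν₁
  have hν₂0 : 0 < ν₂ := by rw [hν₂]; linarith
  have hν₁0 : 0 < ν₁ := lt_min (by linarith) (by linarith)
  have hν₁₂ : ν₁ ≤ ν₂ / 4 := min_le_left _ _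
  have hν₁r : ν₁ ≤ (1 - r') / 2 := min_le_right _ _
  obtain ⟨P, hP⟩ := PSpin.exists_expRare_card_lt hε hε1
  obtain ⟨P', hP'⟩ := PSpin.exists_forall_mul_pow_le
    (((1 - ε) * Real.sqrt (2 * Real.log 2)) ^ 2) (r := 1 - 2 * ν₁) (by linarith) (by linarith) hκ0
  refine ⟨max P P', ν₁, ν₂, c₁, c₂, hν₁0, by linarith, by linarith, by linarith, hc₂0, by linarith,
    fun p hp => ?_⟩
  have hOGP := PSpin.expRare_not_hasOGP (p := p) (ν₁ := ν₁) (ν₂ := ν₂) hε1 hκ0 hr0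
    (by rw [PSpin.sq_level, hκ]; linarith) hcard (by rw [hν₂]; linarith)
    (hP' p (le_trans (le_max_right _ _) hp))
  have hsize := hP p (le_trans (le_max_left _ _) hp)
  have hr' : r' ≤ 1 - 2 * ν₁ := by linarith
  refine ⟨PSpin.shatters_of_expRare hν₁0 (by linarith) hc₂0 hr' hcard' hOGP
    (hsize c₁ (by linarith)), fun δ _ hδ => ?_⟩
  refine PSpin.shatters_of_expRare hν₁0 (by linarith) hc₂0 hr' hcard'
    (hOGP.mono (Eventually.of_forall fun n J hJ h => hJ (h.mono Finset.sdiff_subset)))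
    (PSpin.expRare_card_sdiff_lt hε1 hδ (by linarith) hsize)
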